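/- For real $q\in L^2[0,1]$ let $L_q=-\frac{d^2}{dx^2}+q$ on $L^2[0,1]$ with Dirichlet boundary conditions at $0$ and $1$, i.e. with domain $\{f\in H^2[0,1]: f(0)=f(1)=0\}$. Its eigenvalues are simple, $\lambda_1(q)<\lambda_2(q)<\dots$; let $\phi_{j,q}$ be the eigenfunction for $\lambda_j(q)$ with $\int_0^1\phi_{j,q}^2\,dx=1$ and $\phi_{j,q}'(0)>0$. The heat content of $L_q$ is $Q_q(t)=\int_0^1u(x;t)\,dx$, $t>0$, where $u$ is the solution of $\partial_tu=-L_qu$ for $t>0$ with Dirichlet boundary conditions and $u(\cdot;t)\to1$ in $L^2[0,1]$ as $t\downarrow0$. Two potentials are isospectral if $\lambda_j(q_1)=\lambda_j(q_2)$ for all $j\ge1$, and isoheat if $Q_{q_1}(t)=Q_{q_2}(t)$ for all $t>0$. Theorem. Let $n\ge1$ be an integer and, for $s\in\mathbb{R}$ and $x\in[0,1]$, let $$\gamma_n(s)(x)=-2\,\partial_x^2\log\theta_n(x;s),\qquad \theta_n(x;s)=1+(e^s-1)\int_x^12\sin^2(n\pi r)\,dr .$$ Then $s\mapsto\gamma_n(s)\in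 L^2[0,1]$ is a solution of the flow $\frac{d}{ds}\gamma_n(s)=X_n(\gamma_n(s))$, $\gamma_n(0)=0$, where $X_n(q)=2\frac{d}{dx}(\phi_{n,q}^2)$; for every $s\in\mathbb{R}$ the potential $\gamma_n(s)$ is isospectral to the zero potential; and $\gamma_n$ is not an isoheat deformation, i.e. the potentials $\gamma_n(s)$, $s\in\mathbb{R}$, are not all isoheat to each other. More precisely, there is $\varepsilon>0$ such that for all $s$ with $0<|s|<\varepsilon$ the potentials $\gamma_n(s)$ and $0$ are not isoheat. -/

import Mathlib

open MeasureTheory Set Filter Topology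

noncomputable section

namespace Isoheat

/-- Lebesgue measure on the unit interval `[0,1]`. -/
abbrev unitMeasure : Measure ℝ := volume.restrict (Icc (0 : ℝ) 1)

/-- The real Hilbert space `L²[0,1]`. -/
abbrev L2 : Type := Lp ℝ 2 unitMeasure

/-- `F` belongs to `H²[0,1]`, with derivative `F'` and weak second derivative `F''` in `L²[0,1]`,
and satisfies the Dirichlet boundary conditions at `0` and `1`. -/
structure IsH2Dirichlet (F F' F'' : ℝ → ℝ) : Prop where
  memLp : MemLp F'' 2 unitMeasure
  fst_deriv : ∀ x ∈ Icc (0 : ℝ) 1, F x = F 0 + ∫ r in (0 : ℝ)..x, F' r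
  snd_deriv : ∀ x ∈ Icc (0 : ℝ) 1, F' x = F' 0 + ∫ r in (0 : ℝ)..x, F'' r
  left : F 0 = 0
  right : F 1 = 0

/-- The graph of the Dirichlet Schrödinger operator `L_q = -d²/dx² + q` in `L²[0,1]`:
`f` lies in the domain of `L_q` and `L_q f = g`. -/
def SchrodingerGraph (q f g : L2) : Prop :=
  ∃ F F' F'' : ℝ → ℝ, IsH2Dirichlet F F' F'' ∧ (∀ᵐ x ∂unitMeasure, f x = F x) ∧
    ∀ᵐ x ∂unitMeasure, g x = -F'' x + q x * F x

/-- `lam` is an eigenvalue of `L_q`. -/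
def IsEigenvalue (q : L2) (lam : ℝ) : Prop :=
  ∃ f : L2, f ≠ 0 ∧ SchrodingerGraph q f (lam • f)

/-- `lam` is the `j`-th eigenvalue `λ_j(q)` of `L_q` in increasing order, `j = 1, 2, …`
(all eigenvalues of `L_q` are simple). -/
def IsNthEigenvalue (q : L2) (j : ℕ) (lam : ℝ) : Prop :=
  IsEigenvalue q lam ∧ {m : ℝ | IsEigenvalue q m ∧ m < lam}.encard + 1 = (j : ℕ∞)

/-- `λ_j(q₁) = λ_j(q₂)` for all `j ≥ 1`. -/
def Isospectral (q₁ q₂ : L2) : Prop :=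
  ∀ j : ℕ, 1 ≤ j → ∀ lam : ℝ, IsNthEigenvalue q₁ j lam ↔ IsNthEigenvalue q₂ j lam

/-- `φ` is the (continuously differentiable representative of the) eigenfunction `φ_{j,q}` for
`λ_j(q)`, with derivative `φ'`, normalized by `∫ φ² = 1` and `φ'(0) > 0`. -/
def IsNthEigenfunction (q : L2) (j : ℕ) (φ φ' : ℝ → ℝ) : Prop :=
  ∃ (lam : ℝ) (φ'' : ℝ → ℝ), IsNthEigenvalue q j lam ∧ IsH2Dirichlet φ φ' φ'' ∧
    (∀ᵐ x ∂unitMeasure, -φ'' x + q x * φ x = lam * φ x) ∧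
    (∫ x in (0 : ℝ)..1, φ x ^ 2) = 1 ∧ 0 < φ' 0

/-- `v = X_n(q) = 2 (d/dx) (φ_{n,q})²` in `L²[0,1]`. -/
def IsVectorFieldValue (n : ℕ) (q v : L2) : Prop :=
  ∃ φ φ' : ℝ → ℝ, IsNthEigenfunction q n φ φ' ∧
    ∀ᵐ x ∂unitMeasure, v x = 2 * deriv (fun y => φ y ^ 2) x

/-- `s ↦ γ s` solves `γ'(s) = X_n(γ(s))` in `L²[0,1]` for all real `s`, with `γ(0) = q₀`. -/
def IsFlowLine (n : ℕ) (q₀ : L2) (γ : ℝ → L2) : Prop :=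
  γ 0 = q₀ ∧ ∀ s : ℝ, ∃ v : L2, IsVectorFieldValue n (γ s) v ∧ HasDerivAt γ v s

/-- `u` solves `∂u/∂t = -L_q u` for `t > 0`, with Dirichlet boundary conditions and with
`u(·;t) → 1` in `L²[0,1]` as `t ↓ 0`. -/
def IsHeatSolution (q : L2) (u : ℝ → L2) : Prop :=
  (∀ t : ℝ, 0 < t → ∃ v : L2, SchrodingerGraph q (u t) v ∧ HasDerivAt u (-v) t) ∧
    Tendsto u (𝓝[>] 0) (𝓝 (Lp.const 2 unitMeasure (1 : ℝ)))

open Classical in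
/-- The heat content `Q_q(t) = ∫₀¹ u(x;t) dx`, where `u` is the solution, unique for `t > 0`, of
the heat equation of `L_q` with initial value `1`. -/
def heatContent (q : L2) (t : ℝ) : ℝ :=
  if h : ∃ u : ℝ → L2, IsHeatSolution q u then ∫ x, (h.choose t) x ∂unitMeasure else 0

/-- `Q_{q₁}(t) = Q_{q₂}(t)` for all `t > 0`. -/
def IsIsoheat (q₁ q₂ : L2) : Prop :=
  ∀ t : ℝ, 0 < t → heatContent q₁ t = heatContent q₂ t

/-- The potentials `γ s` are isoheat to each other. -/
def IsIsoheatDeformation (γ : ℝ → L2) : Prop :=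
  ∀ s s' : ℝ, IsIsoheat (γ s) (γ s')

/-- `θ_n(x;s) = 1 + (e^s - 1) ∫_x^1 2 sin²(nπr) dr`. -/
def theta (n : ℕ) (s x : ℝ) : ℝ :=
  1 + (Real.exp s - 1) * ∫ r in x..(1 : ℝ), 2 * Real.sin (n * Real.pi * r) ^ 2

/-- `γ_n(x;s) = -2 ∂_x² log θ_n(x;s)`. -/
def gammaFun (n : ℕ) (s x : ℝ) : ℝ :=
  -2 * iteratedDeriv 2 (fun y => Real.log (theta n s y)) x

theorem contDiff_theta (n : ℕ) (s : ℝ) : ContDiff ℝ 2 (theta n s) := by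
  have key : ∃ g : ℝ → ℝ, ContDiff ℝ 2 g ∧
      ∀ x, ∫ r in x..(1 : ℝ), 2 * Real.sin (n * Real.pi * r) ^ 2 = g x := by
    rcases Nat.eq_zero_or_pos n with rfl | hn
    · exact ⟨fun _ => 0, contDiff_const, fun x => by simp⟩
    · have hc : (n * Real.pi : ℝ) ≠ 0 := by positivity
      set c : ℝ := n * Real.pi
      refine ⟨fun x => 2 * (c⁻¹ * ((Real.sin (c * x) * Real.cos (c * x)
        - Real.sin (c * 1) * Real.cos (c * 1) + c * 1 - c * x) / 2)), by fun_prop, fun x => ?_⟩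
      rw [intervalIntegral.integral_const_mul,
        intervalIntegral.integral_comp_mul_left (fun y => Real.sin y ^ 2) hc, integral_sin_sq,
        smul_eq_mul]
  obtain ⟨g, hg, h⟩ := key
  have : theta n s = fun x => 1 + (Real.exp s - 1) * g x := by
    funext x
    simp only [theta, h]
  rw [this]
  fun_prop

theorem theta_pos (n : ℕ) (s : ℝ) {x : ℝ} (hx : x ∈ Icc (0 : ℝ) 1) : 0 < theta n s x := by
  have hint : ∀ a b : ℝ, IntervalIntegrable (fun r => 2 * Real.sin (n * Real.pi * r) ^ 2)
      volume a b := fun a b => Continuous.intervalIntegrable (by fun_prop) a b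
  have h0 : 0 ≤ ∫ r in x..(1 : ℝ), 2 * Real.sin (n * Real.pi * r) ^ 2 :=
    intervalIntegral.integral_nonneg hx.2 fun r _ => by positivity
  have h0' : 0 ≤ ∫ r in (0 : ℝ)..x, 2 * Real.sin (n * Real.pi * r) ^ 2 :=
    intervalIntegral.integral_nonneg hx.1 fun r _ => by positivity
  have hadd := intervalIntegral.integral_add_adjacent_intervals (hint 0 x) (hint x 1)
  have htot : ∫ r in (0 : ℝ)..1, 2 * Real.sin (n * Real.pi * r) ^ 2 ≤ 1 := by
    rcases Nat.eq_zero_or_pos n with rfl | hn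
    · simp
    · have hc : (n * Real.pi : ℝ) ≠ 0 := by positivity
      rw [intervalIntegral.integral_const_mul,
        intervalIntegral.integral_comp_mul_left (fun y => Real.sin y ^ 2) hc, integral_sin_sq]
      simp [Real.sin_nat_mul_pi]
      field_simp
      exact le_refl _
  have h1 : ∫ r in x..(1 : ℝ), 2 * Real.sin (n * Real.pi * r) ^ 2 ≤ 1 := by linarith
  have he := Real.exp_pos s
  rw [theta]
  set b := ∫ r in x..(1 : ℝ), 2 * Real.sin (n * Real.pi * r) ^ 2
  by_cases hb : b = 0
  · simp [hb]
  · have : 0 < b := lt_of_le_of_ne h0 (Ne.symm hb)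
    nlinarith [mul_pos he this]

theorem memLp_gammaFun (n : ℕ) (s : ℝ) : MemLp (gammaFun n s) 2 unitMeasure := by
  have hU : IsOpen {x : ℝ | 0 < theta n s x} :=
    isOpen_lt continuous_const (contDiff_theta n s).continuous
  have hsub : Icc (0 : ℝ) 1 ⊆ {x : ℝ | 0 < theta n s x} := fun x hx => theta_pos n s hx
  have hc : ContDiffOn ℝ 2 (fun y => Real.log (theta n s y)) {x : ℝ | 0 < theta n s x} :=
    (contDiff_theta n s).contDiffOn.log fun x hx => ne_of_gt hx
  have h2 : ContinuousOn (iteratedDeriv 2 fun y => Real.log (theta n s y)) (Icc (0 : ℝ) 1) := by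
    have h := hc.continuousOn_iteratedDerivWithin (m := 2) le_rfl hU.uniqueDiffOn
    exact (h.congr fun x hx => (iteratedDerivWithin_of_isOpen hU hx).symm).mono hsub
  have h3 : ContinuousOn (gammaFun n s) (Icc (0 : ℝ) 1) := continuousOn_const.mul h2
  obtain ⟨C, hC⟩ := isCompact_Icc.exists_bound_of_continuousOn h3
  exact MemLp.of_bound (h3.aestronglyMeasurable measurableSet_Icc) C
    ((ae_restrict_iff' measurableSet_Icc).2 (Eventually.of_forall hC))

/-- The curve `s ↦ γ_n(s)` in `L²[0,1]`. -/
def gammaFlow (n : ℕ) (s : ℝ) : L2 := (memLp_gammaFun n s).toLp (gammaFun n s)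

end Isoheat

end

noncomputable section

namespace Isoheat

/-! The potentials and all their eigenfunctions are explicit. Put c = e^s - 1, s_k = √2 sin(kπx) and
P_k(x) = ∫_x^1 s_n s_k. The double commutation transform f_k = s_k - c (s_n/θ_n) P_k solves the
Dirichlet problem for γ_n(s) at the unchanged eigenvalue (kπ)². The f_k are orthogonal and complete,
and only f_n = s_n/θ_n needs rescaling, by e^{s/2}. Hence there are no other eigenvalues
(`isEigenSystem_potential`, `IsEigenSystem.isEigenvalue_iff`).

The flow equation comes from ∂_x ∂_s log θ_n = -e^s (s_n/θ_n)², which gives ∂_s γ_n = 2 d/dx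
(e^{s/2} s_n/θ_n)². The derivative holds in L² because it is jointly continuous over the compact
interval.

For the heat content, expansion in eigenfunctions gives Q(t) = Σ e^{-λ_j t} (∫ f_j)². The exponents
are common to all potentials of the family, so uniqueness of Dirichlet series makes isoheat
potentials agree in every (∫ f_j)² (`IsEigenSystem.integral_sq_eq_of_isIsoheat`). The index k = 2n
separates them: s_{2n} has mean zero, whereas P_{2n} is a negative multiple of sin³(nπx), so the
mean of f_{2n} is c times a positive multiple of ∫ sin⁴(nπx)/θ_n. This is nonzero for every s ≠ 0
(`integral_transform_two_mul_ne_zero`), so no smallness of s is needed. -/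

/-! ### Integration and primitives on the unit interval -/

theorem integral_unitMeasure (f : ℝ → ℝ) :
    ∫ x, f x ∂unitMeasure = ∫ x in (0 : ℝ)..1, f x := by
  rw [integral_Icc_eq_integral_Ioc, intervalIntegral.integral_of_le zero_le_one]

theorem integrable_unitMeasure_iff {f : ℝ → ℝ} :
    Integrable f unitMeasure ↔ IntervalIntegrable f volume 0 1 := by
  rw [intervalIntegrable_iff_integrableOn_Icc_of_le zero_le_one, IntegrableOn]

theorem ae_unitMeasure_of_forall {p : ℝ → Prop} (h : ∀ x ∈ Icc (0 : ℝ) 1, p x) :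
    ∀ᵐ x ∂unitMeasure, p x :=
  (ae_restrict_iff' measurableSet_Icc).2 (Eventually.of_forall h)

theorem ae_unitMeasure_of_forall_Ioo {p : ℝ → Prop} (h : ∀ x ∈ Ioo (0 : ℝ) 1, p x) :
    ∀ᵐ x ∂unitMeasure, p x := by
  rw [unitMeasure, ← Measure.restrict_congr_set Ioo_ae_eq_Icc]
  exact (ae_restrict_iff' measurableSet_Ioo).2 (Eventually.of_forall h)

theorem integral_congr_unitMeasure {f g : ℝ → ℝ} (h : ∀ᵐ x ∂unitMeasure, f x = g x) :
    ∫ x in (0 : ℝ)..1, f x = ∫ x in (0 : ℝ)..1, g x := by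
  rw [← integral_unitMeasure, ← integral_unitMeasure]
  exact integral_congr_ae h

theorem integral_congr_unitMeasure_of_mem {f g : ℝ → ℝ} (h : ∀ᵐ y ∂unitMeasure, f y = g y)
    {x : ℝ} (hx : x ∈ Icc (0 : ℝ) 1) : ∫ r in (0 : ℝ)..x, f r = ∫ r in (0 : ℝ)..x, g r := by
  apply intervalIntegral.integral_congr_ae
  filter_upwards [(ae_restrict_iff' measurableSet_Icc).1 h] with y hy hyx
  rw [uIoc_of_le hx.1] at hyx
  exact hy ⟨hyx.1.le, hyx.2.trans hx.2⟩

theorem ContinuousOn.memLp_unitMeasure {f : ℝ → ℝ} (hf : ContinuousOn f (Icc 0 1)) :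
    MemLp f 2 unitMeasure := by
  obtain ⟨C, hC⟩ := isCompact_Icc.exists_bound_of_continuousOn hf
  exact MemLp.of_bound (hf.aestronglyMeasurable measurableSet_Icc) C (ae_unitMeasure_of_forall hC)

theorem MemLp.intervalIntegrable_unit {f : ℝ → ℝ} (hf : MemLp f 2 unitMeasure) :
    IntervalIntegrable f volume 0 1 :=
  integrable_unitMeasure_iff.1 (hf.integrable (by norm_num))

theorem ContinuousOn.intervalIntegrable_unit {f : ℝ → ℝ} (hf : ContinuousOn f (Icc 0 1)) :
    IntervalIntegrable f volume 0 1 :=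
  ContinuousOn.intervalIntegrable_of_Icc zero_le_one hf

theorem L2.intervalIntegrable (h : L2) : IntervalIntegrable h volume 0 1 :=
  MemLp.intervalIntegrable_unit (Lp.memLp h)

/-- The product rule for primitives of integrable functions, integrated over `[0,1]`. -/
theorem integral_mul_add_mul_of_primitive {p P g G : ℝ → ℝ}
    (hp : IntervalIntegrable p volume 0 1)
    (hP : ∀ x ∈ Icc (0 : ℝ) 1, P x = P 0 + ∫ r in (0 : ℝ)..x, p r)
    (hg : IntervalIntegrable g volume 0 1)
    (hG : ∀ x ∈ Icc (0 : ℝ) 1, G x = G 0 + ∫ r in (0 : ℝ)..x, g r) :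
    ∫ x in (0 : ℝ)..1, (p x * G x + P x * g x) = P 1 * G 1 - P 0 * G 0 := by
  have hac : ∀ {p : ℝ → ℝ} (c : ℝ), IntervalIntegrable p volume 0 1 →
      AbsolutelyContinuousOnInterval (fun x => c + ∫ r in (0 : ℝ)..x, p r) 0 1 := fun c hp =>
    AbsolutelyContinuousOnInterval.fun_add
      (contDiff_const.contDiffOn.absolutelyContinuousOnInterval)
      (hp.absolutelyContinuousOnInterval_intervalIntegral (by simp))
  have h := AbsolutelyContinuousOnInterval.integral_deriv_mul_eq_sub (hac (P 0) hp) (hac (G 0) hg)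
  have e0 : (0 : ℝ) ∈ Icc (0 : ℝ) 1 := by simp
  have e1 : (1 : ℝ) ∈ Icc (0 : ℝ) 1 := by simp
  rw [← hP 1 e1, ← hG 1 e1, ← hP 0 e0, ← hG 0 e0] at h
  rw [← h]
  apply intervalIntegral.integral_congr_ae
  filter_upwards [hp.ae_hasDerivAt_integral, hg.ae_hasDerivAt_integral] with x h1 h2 hx
  have hx' : x ∈ uIcc (0 : ℝ) 1 := uIoc_subset_uIcc hx
  have hx'' : x ∈ Icc (0 : ℝ) 1 := by rwa [uIcc_of_le zero_le_one] at hx'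
  rw [((h1 hx' 0 (by simp)).const_add (P 0)).deriv, ((h2 hx' 0 (by simp)).const_add (G 0)).deriv,
    hP x hx'', hG x hx'']

theorem eq_add_integral_of_hasDerivAt {g g' : ℝ → ℝ}
    (hg : ∀ x ∈ Icc (0 : ℝ) 1, HasDerivAt g (g' x) x) (hg' : ContinuousOn g' (Icc 0 1)) :
    ∀ x ∈ Icc (0 : ℝ) 1, g x = g 0 + ∫ r in (0 : ℝ)..x, g' r := by
  intro x hx
  have hs : uIcc 0 x ⊆ Icc (0 : ℝ) 1 := by
    rw [uIcc_of_le hx.1]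
    exact Icc_subset_Icc_right hx.2
  rw [intervalIntegral.integral_eq_sub_of_hasDerivAt (fun y hy => hg y (hs hy))
    ((hg'.mono hs).intervalIntegrable)]
  ring

theorem continuousOn_of_primitive {p P : ℝ → ℝ} (hp : IntervalIntegrable p volume 0 1)
    (hP : ∀ x ∈ Icc (0 : ℝ) 1, P x = P 0 + ∫ r in (0 : ℝ)..x, p r) :
    ContinuousOn P (Icc 0 1) := by
  have h := (intervalIntegral.continuousOn_primitive_interval' hp left_mem_uIcc)
  rw [uIcc_of_le zero_le_one] at h
  exact (continuousOn_const.add h).congr hP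

theorem hasDerivWithinAt_integral_of_continuousOn {p : ℝ → ℝ} (hp : ContinuousOn p (Icc 0 1))
    {x : ℝ} (hx : x ∈ Icc (0 : ℝ) 1) :
    HasDerivWithinAt (fun y => ∫ r in (0 : ℝ)..y, p r) (p x) (Icc 0 1) x := by
  have : Fact (x ∈ Icc (0 : ℝ) 1) := ⟨hx⟩
  refine intervalIntegral.integral_hasDerivWithinAt_right
    ((hp.mono ?_).intervalIntegrable) ?_ (hp x hx)
  · rw [uIcc_of_le hx.1]
    exact Icc_subset_Icc_right hx.2
  · exact hp.stronglyMeasurableAtFilter_nhdsWithin measurableSet_Icc x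

/-! ### Completeness of the sines -/

/-- An `L²` function orthogonal to all `sin(kπx)`, `k ≥ 1`, vanishes. -/
theorem L2.eq_zero_of_integral_mul_sin (h : L2)
    (hh : ∀ j : ℕ, ∫ x in (0 : ℝ)..1, h x * Real.sin ((j + 1 : ℝ) * Real.pi * x) = 0) : h = 0 := by
  have hint : ∀ {G : ℝ → ℝ}, ContinuousOn G (Icc 0 1) →
      IntervalIntegrable (fun x => h x * G x) volume 0 1 := fun hG =>
    (L2.intervalIntegrable h).mul_continuousOn (by rwa [uIcc_of_le zero_le_one])
  -- The product formula for sin(aπx) cos(πx) raises the power of the cosine at the cost of shifting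
  -- the frequency by ±1. The lowest frequency needs only sin(2πx) = 2 sin(πx) cos(πx).
  have hpow : ∀ k j : ℕ, ∫ x in (0 : ℝ)..1,
      h x * (Real.sin ((j + 1 : ℝ) * Real.pi * x) * Real.cos (Real.pi * x) ^ k) = 0 := by
    intro k
    induction k with
    | zero => intro j; simpa using hh j
    | succ k ih =>
      intro j
      rcases j with _ | j
      · have h1 := ih 1
        have h2 := congrArg (fun z => 2⁻¹ * z) h1
        simp only [mul_zero, ← intervalIntegral.integral_const_mul] at h2
        refine Eq.trans ?_ h2
        congr 1; funext x
        have : Real.sin ((((1 : ℕ) : ℝ) + 1) * Real.pi * x)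
            = 2 * Real.sin (Real.pi * x) * Real.cos (Real.pi * x) := by
          rw [← Real.sin_two_mul]; congr 1; push_cast; ring
        rw [this]; push_cast
        rw [show (0 + 1) * Real.pi * x = Real.pi * x by ring]
        ring
      · have h1 := ih (j + 2)
        have h2 := ih j
        have hs : ∀ x, Real.sin (((j + 1 : ℕ) + 1 : ℝ) * Real.pi * x) * Real.cos (Real.pi * x)
            = 2⁻¹ * (Real.sin (((j + 2 : ℕ) + 1 : ℝ) * Real.pi * x)
              + Real.sin ((j + 1 : ℝ) * Real.pi * x)) := by
          intro x
          have e1 : ((j + 2 : ℕ) + 1 : ℝ) * Real.pi * x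
              = ((j + 1 : ℕ) + 1 : ℝ) * Real.pi * x + Real.pi * x := by push_cast; ring
          have e2 : (j + 1 : ℝ) * Real.pi * x
              = ((j + 1 : ℕ) + 1 : ℝ) * Real.pi * x - Real.pi * x := by push_cast; ring
          rw [e1, e2, Real.sin_add, Real.sin_sub]; ring
        have : (fun x => h x * (Real.sin (((j + 1 : ℕ) + 1 : ℝ) * Real.pi * x)
              * Real.cos (Real.pi * x) ^ (k + 1)))
            = fun x => 2⁻¹ * (h x * (Real.sin (((j + 2 : ℕ) + 1 : ℝ) * Real.pi * x)
                * Real.cos (Real.pi * x) ^ k)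
              + h x * (Real.sin ((j + 1 : ℝ) * Real.pi * x) * Real.cos (Real.pi * x) ^ k)) := by
          funext x
          rw [pow_succ', ← mul_assoc (Real.sin _), hs]; ring
        rw [this, intervalIntegral.integral_const_mul, intervalIntegral.integral_add, h1, h2]
        · simp
        · exact hint (by fun_prop)
        · exact hint (by fun_prop)
  have hpoly : ∀ p : Polynomial ℝ, ∫ x in (0 : ℝ)..1,
      h x * (Real.sin (Real.pi * x) * p.eval (Real.cos (Real.pi * x))) = 0 := by
    intro p
    induction p using Polynomial.induction_on' with
    | add p q hp hq =>
      simp only [Polynomial.eval_add, mul_add]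
      rw [intervalIntegral.integral_add, hp, hq, add_zero]
      · exact hint (by fun_prop)
      · exact hint (by fun_prop)
    | monomial k a =>
      have h1 := hpow k 0
      have h2 := congrArg (fun z => a * z) h1
      simp only [mul_zero, ← intervalIntegral.integral_const_mul] at h2
      refine Eq.trans ?_ h2
      congr 1; funext x
      simp only [Polynomial.eval_monomial]
      push_cast
      rw [show (0 + 1) * Real.pi * x = Real.pi * x by ring]
      ring
  have hg : IntervalIntegrable (fun x => h x * Real.sin (Real.pi * x)) volume 0 1 :=
    hint (by fun_prop)
  have hcont : ∀ G : ℝ → ℝ, Continuous G →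
      ∫ x in (0 : ℝ)..1, h x * Real.sin (Real.pi * x) * G x = 0 := by
    intro G hG
    set M := ∫ x in (0 : ℝ)..1, |h x * Real.sin (Real.pi * x)| with hM
    have hM0 : 0 ≤ M := intervalIntegral.integral_nonneg zero_le_one fun x _ => abs_nonneg _
    have hle : ∀ ε > 0, |∫ x in (0 : ℝ)..1, h x * Real.sin (Real.pi * x) * G x| ≤ ε * M := by
      intro ε hε
      -- In the variable y = cos(πx), Weierstrass approximates G uniformly on [0,1] by polynomials
      -- in cos(πx), whose integrals against h sin(πx) vanish.
      obtain ⟨p, hp⟩ := exists_polynomial_near_of_continuousOn (-1) 1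
        (fun y => G (Real.arccos y / Real.pi))
        (by
          have := Real.continuous_arccos
          fun_prop) ε hε
      have hp' : ∀ x ∈ Icc (0 : ℝ) 1, |G x - p.eval (Real.cos (Real.pi * x))| ≤ ε := by
        intro x hx
        have hpi := Real.pi_pos
        have h1 := hp (Real.cos (Real.pi * x)) ⟨Real.neg_one_le_cos _, Real.cos_le_one _⟩
        rw [Real.arccos_cos (by have := hx.1; positivity) (by nlinarith [hx.2]),
          mul_div_cancel_left₀ _ hpi.ne', abs_sub_comm] at h1
        exact h1.le
      have e : ∫ x in (0 : ℝ)..1, h x * Real.sin (Real.pi * x) * G x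
          = ∫ x in (0 : ℝ)..1, h x * Real.sin (Real.pi * x)
            * (G x - p.eval (Real.cos (Real.pi * x))) := by
        refine (sub_zero _).symm.trans ((congrArg _ (hpoly p).symm).trans ?_)
        rw [← intervalIntegral.integral_sub]
        · congr 1; funext x; ring
        · exact hg.mul_continuousOn (by fun_prop)
        · exact hint (by fun_prop)
      rw [e]
      refine (intervalIntegral.abs_integral_le_integral_abs zero_le_one).trans ?_
      rw [hM, ← intervalIntegral.integral_const_mul]
      refine intervalIntegral.integral_mono_on zero_le_one ?_ (hg.abs.const_mul _) ?_
      · exact (hg.mul_continuousOn (by fun_prop)).abs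
      · intro x hx
        rw [abs_mul, mul_comm]
        exact mul_le_mul_of_nonneg_right (hp' x hx) (abs_nonneg _)
    by_contra hne
    have hpos := abs_pos.2 hne
    have := hle (|∫ x in (0 : ℝ)..1, h x * Real.sin (Real.pi * x) * G x| / (2 * (M + 1)))
      (by positivity)
    have h2 : |∫ x in (0 : ℝ)..1, h x * Real.sin (Real.pi * x) * G x| / (2 * (M + 1)) * M
        < |∫ x in (0 : ℝ)..1, h x * Real.sin (Real.pi * x) * G x| := by
      rw [div_mul_eq_mul_div, div_lt_iff₀ (by positivity)]
      nlinarith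
    linarith
  have h0 : ∀ᵐ x ∂unitMeasure, h x * Real.sin (Real.pi * x) = 0 := by
    refine ae_eq_zero_of_integral_contDiff_smul_eq_zero
      (integrable_unitMeasure_iff.2 hg).locallyIntegrable fun G hG _ => ?_
    rw [integral_unitMeasure]
    refine Eq.trans ?_ (hcont G hG.continuous)
    congr 1; funext x; simp only [smul_eq_mul]; ring
  rw [Lp.eq_zero_iff_ae_eq_zero]
  have h1 : ∀ᵐ x ∂unitMeasure, Real.sin (Real.pi * x) ≠ 0 :=
    ae_unitMeasure_of_forall_Ioo fun x hx => (Real.sin_pos_of_pos_of_lt_pi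
      (mul_pos Real.pi_pos hx.1) (by nlinarith [Real.pi_pos, hx.2])).ne'
  filter_upwards [h0, h1] with x hx hx'
  simpa [hx'] using hx

/-! ### The common eigenvalues and summability -/

/-- The Dirichlet eigenvalues `((j+1)π)²`, `j ≥ 0`, of the zero potential. -/
def freeEigenvalue (j : ℕ) : ℝ := ((j + 1 : ℝ) * Real.pi) ^ 2

theorem sq_le_freeEigenvalue (j : ℕ) : (j + 1 : ℝ) ^ 2 ≤ freeEigenvalue j := by
  rw [freeEigenvalue, mul_pow]
  have : 1 ≤ Real.pi ^ 2 := by nlinarith [Real.pi_gt_three]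
  nlinarith [sq_nonneg (j + 1 : ℝ)]

theorem one_le_freeEigenvalue (j : ℕ) : 1 ≤ freeEigenvalue j := by
  have := sq_le_freeEigenvalue j
  have h : (0 : ℝ) ≤ j := j.cast_nonneg
  nlinarith

theorem freeEigenvalue_strictMono : StrictMono freeEigenvalue := by
  intro i j hij
  have : (i : ℝ) < j := by exact_mod_cast hij
  unfold freeEigenvalue
  gcongr

/-- Since y²/2 ≤ e^y for y ≥ 0, each term is at most 2/(t²λ_j) ≤ 2/(t²(j+1)²). -/
theorem summable_freeEigenvalue_mul_exp {t : ℝ} (ht : 0 < t) :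
    Summable fun j => freeEigenvalue j * Real.exp (-freeEigenvalue j * t) := by
  have hs : Summable fun j : ℕ => 2 / t ^ 2 * (1 / ((j : ℝ) + 1) ^ 2) := by
    refine Summable.mul_left _ ?_
    have := (summable_nat_add_iff 1).2 (Real.summable_one_div_nat_pow.2 (one_lt_two))
    simpa using this
  refine hs.of_nonneg_of_le (fun j => ?_) fun j => ?_
  · have := one_le_freeEigenvalue j
    positivity
  · have h1 := one_le_freeEigenvalue j
    have h2 := sq_le_freeEigenvalue j
    set l := freeEigenvalue j
    have hl : 0 < l := by linarith
    have hexp : (l * t) ^ 2 / 2 ≤ Real.exp (l * t) := by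
      have := Real.quadratic_le_exp_of_nonneg (x := l * t) (by positivity)
      have : 0 ≤ l * t := by positivity
      linarith
    have : l * Real.exp (-l * t) ≤ 2 / t ^ 2 * (1 / l) := by
      rw [neg_mul, Real.exp_neg, ← div_eq_mul_inv, div_le_iff₀ (Real.exp_pos _)]
      calc l = 2 / t ^ 2 * (1 / l) * ((l * t) ^ 2 / 2) := by field_simp
        _ ≤ _ := by gcongr
    refine this.trans ?_
    gcongr

theorem hasSum_intervalIntegral_of_bound {g : ℕ → ℝ → ℝ} {B : ℕ → ℝ}
    (hg : ∀ j, ContinuousOn (g j) (Icc 0 1)) (hB : ∀ j, ∀ x ∈ Icc (0 : ℝ) 1, |g j x| ≤ B j)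
    (hs : Summable B) {x : ℝ} (hx : x ∈ Icc (0 : ℝ) 1) :
    HasSum (fun j => ∫ r in (0 : ℝ)..x, g j r) (∫ r in (0 : ℝ)..x, ∑' j, g j r) := by
  have hsub : uIoc 0 x ⊆ Icc (0 : ℝ) 1 := by
    rw [uIoc_of_le hx.1]
    exact fun y hy => ⟨hy.1.le, hy.2.trans hx.2⟩
  refine intervalIntegral.hasSum_integral_of_dominated_convergence (fun j _ => B j) ?_ ?_ ?_ ?_ ?_
  · intro j
    exact ((hg j).mono hsub).aestronglyMeasurable measurableSet_uIoc
  · exact fun j => Eventually.of_forall fun y hy => hB j y (hsub hy)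
  · exact Eventually.of_forall fun _ _ => hs
  · exact intervalIntegrable_const
  · exact Eventually.of_forall fun y hy =>
      (Summable.of_norm_bounded hs fun j => hB j y (hsub hy)).hasSum

theorem inner_eq_integral (f g : L2) : inner ℝ f g = ∫ x in (0 : ℝ)..1, g x * f x := by
  rw [L2.inner_def, ← integral_unitMeasure]
  rfl

/-! ### Spectral theory of a complete eigenfunction system -/

/-- `f j` are the normalized Dirichlet eigenfunctions, with derivatives `f' j` and eigenvalues
`freeEigenvalue j`, of the continuous potential `q`; they are uniformly bounded and complete. -/
structure IsEigenSystem (q : ℝ → ℝ) (f f' : ℕ → ℝ → ℝ) : Prop where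
  continuousOn : ContinuousOn q (Icc 0 1)
  hasDerivAt : ∀ j, ∀ x ∈ Icc (0 : ℝ) 1, HasDerivAt (f j) (f' j x) x
  hasDerivAt' : ∀ j, ∀ x ∈ Icc (0 : ℝ) 1, HasDerivAt (f' j) ((q x - freeEigenvalue j) * f j x) x
  left : ∀ j, f j 0 = 0
  right : ∀ j, f j 1 = 0
  bounded : ∃ M : ℝ, ∀ j, ∀ x ∈ Icc (0 : ℝ) 1, |f j x| ≤ M
  orthonormal : ∀ i j, ∫ x in (0 : ℝ)..1, f i x * f j x = if i = j then 1 else 0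
  complete : ∀ h : L2, (∀ j, ∫ x in (0 : ℝ)..1, h x * f j x = 0) → h = 0

namespace IsEigenSystem

variable {q : ℝ → ℝ} {f f' : ℕ → ℝ → ℝ}

theorem continuousOn_fun (E : IsEigenSystem q f f') (j : ℕ) : ContinuousOn (f j) (Icc 0 1) :=
  fun x hx => (E.hasDerivAt j x hx).continuousAt.continuousWithinAt

theorem continuousOn_deriv (E : IsEigenSystem q f f') (j : ℕ) : ContinuousOn (f' j) (Icc 0 1) :=
  fun x hx => (E.hasDerivAt' j x hx).continuousAt.continuousWithinAt

theorem continuousOn_deriv' (E : IsEigenSystem q f f') (j : ℕ) :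
    ContinuousOn (fun x => (q x - freeEigenvalue j) * f j x) (Icc 0 1) :=
  (E.continuousOn.sub continuousOn_const).mul (E.continuousOn_fun j)

theorem isH2Dirichlet (E : IsEigenSystem q f f') (j : ℕ) :
    IsH2Dirichlet (f j) (f' j) (fun x => (q x - freeEigenvalue j) * f j x) where
  memLp := ContinuousOn.memLp_unitMeasure (E.continuousOn_deriv' j)
  fst_deriv := eq_add_integral_of_hasDerivAt (E.hasDerivAt j) (E.continuousOn_deriv j)
  snd_deriv := eq_add_integral_of_hasDerivAt (E.hasDerivAt' j) (E.continuousOn_deriv' j)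
  left := E.left j
  right := E.right j

/-- The eigenfunctions as elements of `L²[0,1]`. -/
def vec (E : IsEigenSystem q f f') (j : ℕ) : L2 :=
  (ContinuousOn.memLp_unitMeasure (E.continuousOn_fun j)).toLp (f j)

theorem vec_ae (E : IsEigenSystem q f f') (j : ℕ) : ∀ᵐ x ∂unitMeasure, E.vec j x = f j x :=
  MemLp.coeFn_toLp _

theorem inner_vec (E : IsEigenSystem q f f') (j : ℕ) (h : L2) :
    inner ℝ (E.vec j) h = ∫ x in (0 : ℝ)..1, h x * f j x := by
  rw [inner_eq_integral]
  apply integral_congr_unitMeasure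
  filter_upwards [E.vec_ae j] with x hx
  rw [hx]

theorem orthonormal_vec (E : IsEigenSystem q f f') : Orthonormal ℝ E.vec := by
  rw [orthonormal_iff_ite]
  intro i j
  rw [inner_vec, ← E.orthonormal i j]
  apply integral_congr_unitMeasure
  filter_upwards [E.vec_ae j] with x hx
  rw [hx, mul_comm]

theorem ext_inner (E : IsEigenSystem q f f') {g h : L2}
    (H : ∀ j, inner ℝ (E.vec j) g = inner ℝ (E.vec j) h) : g = h := by
  rw [← sub_eq_zero]
  refine E.complete _ fun j => ?_
  rw [← E.inner_vec, inner_sub_right, H, sub_self]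

/-- The eigenfunctions as a Hilbert basis of `L²[0,1]`. -/
def basis (E : IsEigenSystem q f f') : HilbertBasis ℕ ℝ L2 :=
  HilbertBasis.mkOfOrthogonalEqBot E.orthonormal_vec <| by
    rw [Submodule.eq_bot_iff]
    intro h hh
    refine E.complete h fun j => ?_
    rw [← E.inner_vec]
    exact hh _ (Submodule.subset_span (mem_range_self j))

theorem basis_apply (E : IsEigenSystem q f f') (j : ℕ) : E.basis j = E.vec j := by
  rw [basis, HilbertBasis.coe_mkOfOrthogonalEqBot]

/-- By Rolle, f_j' has a zero, so |f_j'| is at most the supremum of |f_j''| on an interval of length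
one. This growth of order λ_j is crude, but heat coefficients decay fast enough to absorb it. -/
theorem exists_bound_deriv (E : IsEigenSystem q f f') :
    ∃ K : ℝ, 0 ≤ K ∧ ∀ j, ∀ x ∈ Icc (0 : ℝ) 1, |f j x| ≤ K ∧ |f' j x| ≤ K * freeEigenvalue j ∧
      |(q x - freeEigenvalue j) * f j x| ≤ K * freeEigenvalue j := by
  obtain ⟨M, hM⟩ := E.bounded
  obtain ⟨C, hC⟩ := isCompact_Icc.exists_bound_of_continuousOn E.continuousOn
  have h0 : (0 : ℝ) ∈ Icc (0 : ℝ) 1 := by simp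
  have hM0 : 0 ≤ M := (abs_nonneg _).trans (hM 0 0 h0)
  have hC0 : 0 ≤ C := (norm_nonneg _).trans (hC 0 h0)
  have h3 : ∀ j, ∀ x ∈ Icc (0 : ℝ) 1,
      |(q x - freeEigenvalue j) * f j x| ≤ (C + 1) * M * freeEigenvalue j := by
    intro j x hx
    have h1 := one_le_freeEigenvalue j
    rw [abs_mul]
    have h2 : |q x - freeEigenvalue j| ≤ (C + 1) * freeEigenvalue j := by
      refine (abs_sub _ _).trans ?_
      rw [abs_of_nonneg (by linarith : 0 ≤ freeEigenvalue j)]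
      have := hC x hx
      rw [Real.norm_eq_abs] at this
      nlinarith
    calc _ ≤ (C + 1) * freeEigenvalue j * M :=
          mul_le_mul h2 (hM j x hx) (abs_nonneg _) (by positivity)
      _ = _ := by ring
  refine ⟨(C + 1) * M, by positivity, fun j x hx => ⟨?_, ?_, h3 j x hx⟩⟩
  · refine (hM j x hx).trans ?_
    nlinarith
  · obtain ⟨c, hc, hc0⟩ := exists_hasDerivAt_eq_zero zero_lt_one (E.continuousOn_fun j)
      ((E.left j).trans (E.right j).symm) fun y hy => E.hasDerivAt j y (Ioo_subset_Icc_self hy)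
    have hcI := Ioo_subset_Icc_self hc
    have h := (convex_Icc (0 : ℝ) 1).norm_image_sub_le_of_norm_hasDerivWithin_le
      (fun y hy => (E.hasDerivAt' j y hy).hasDerivWithinAt) (fun y hy => h3 j y hy) hcI hx
    rw [hc0, sub_zero, Real.norm_eq_abs] at h
    refine h.trans (mul_le_of_le_one_right ?_ ?_)
    · have := one_le_freeEigenvalue j
      positivity
    · rw [Real.norm_eq_abs, abs_le]
      constructor <;> linarith [hx.1, hx.2, hcI.1, hcI.2]

theorem norm_vec (E : IsEigenSystem q f f') (j : ℕ) : ‖E.vec j‖ = 1 := E.orthonormal_vec.1 j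

theorem summable_smul_vec (E : IsEigenSystem q f f') {b : ℕ → ℝ} (hb : Summable fun j => |b j|) :
    Summable fun j => b j • E.vec j :=
  Summable.of_norm_bounded hb fun j => by rw [norm_smul, E.norm_vec, mul_one, Real.norm_eq_abs]

theorem inner_vec_tsum (E : IsEigenSystem q f f') {b : ℕ → ℝ} (hb : Summable fun j => |b j|)
    (j : ℕ) : inner ℝ (E.vec j) (∑' i, b i • E.vec i) = b j := by
  have h := (E.summable_smul_vec hb).hasSum.mapL (innerSL ℝ (E.vec j))
  have h' : HasSum (fun i => if i = j then b j else 0)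
      (inner ℝ (E.vec j) (∑' i, b i • E.vec i)) := by
    convert! h using 1
    funext i
    simp only [innerSL_apply_apply, inner_smul_right,
      (orthonormal_iff_ite.1 E.orthonormal_vec) j i]
    rcases eq_or_ne i j with rfl | hij
    · simp
    · simp [hij, hij.symm]
  exact h'.unique (hasSum_ite_eq j (b j))

/-- The uniformly convergent pointwise series and the L² series have the same inner products with
every eigenfunction, so completeness identifies them. -/
theorem tsum_vec_ae (E : IsEigenSystem q f f') {b : ℕ → ℝ} (hb : Summable fun j => |b j|) :
    ∀ᵐ x ∂unitMeasure, (∑' i, b i • E.vec i : L2) x = ∑' i, b i * f i x := by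
  obtain ⟨K, hK0, hK⟩ := E.exists_bound_deriv
  have hbd : ∀ i, ∀ x ∈ Icc (0 : ℝ) 1, |b i * f i x| ≤ |b i| * K := fun i x hx => by
    rw [abs_mul]
    exact mul_le_mul_of_nonneg_left (hK i x hx).1 (abs_nonneg _)
  have hbf : ∀ i, ContinuousOn (fun x => b i * f i x) (Icc 0 1) := fun i =>
    continuousOn_const.mul (E.continuousOn_fun i)
  have hcont : ContinuousOn (fun x => ∑' i, b i * f i x) (Icc 0 1) :=
    continuousOn_tsum hbf (hb.mul_right K) hbd
  have hL := ContinuousOn.memLp_unitMeasure hcont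
  have key : (∑' i, b i • E.vec i : L2) = hL.toLp _ := by
    refine E.ext_inner fun j => ?_
    rw [E.inner_vec_tsum hb, E.inner_vec]
    have e : ∫ x in (0 : ℝ)..1, hL.toLp _ x * f j x
        = ∫ x in (0 : ℝ)..1, ∑' i, b i * f i x * f j x := by
      apply integral_congr_unitMeasure
      filter_upwards [hL.coeFn_toLp] with x hx
      rw [hx, tsum_mul_right]
    rw [e]
    have h := hasSum_intervalIntegral_of_bound (g := fun i x => b i * f i x * f j x)
      (B := fun i => |b i| * K * K) (fun i => (hbf i).mul (E.continuousOn_fun j))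
      (fun i x hx => by
        rw [abs_mul]
        exact mul_le_mul (hbd i x hx) (hK j x hx).1 (abs_nonneg _) (by positivity))
      ((hb.mul_right K).mul_right K) (x := 1) (by simp)
    have h' : (fun i => ∫ x in (0 : ℝ)..1, b i * f i x * f j x)
        = fun i => if i = j then b j else 0 := by
      funext i
      simp only [mul_assoc, intervalIntegral.integral_const_mul, E.orthonormal]
      rcases eq_or_ne i j with rfl | hij
      · simp
      · simp [hij]
    rw [h'] at h
    exact (hasSum_ite_eq j (b j)).unique h
  rw [key]
  exact hL.coeFn_toLp

/-- The Schrödinger operator acts termwise on rapidly convergent eigenfunction expansions. -/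
theorem schrodingerGraph_tsum (E : IsEigenSystem q f f') {Q : L2}
    (hQ : ∀ᵐ x ∂unitMeasure, Q x = q x) {b : ℕ → ℝ}
    (hb : Summable fun j => |freeEigenvalue j * b j|) :
    SchrodingerGraph Q (∑' j, b j • E.vec j) (∑' j, (freeEigenvalue j * b j) • E.vec j) := by
  have hle : ∀ j, |b j| ≤ |freeEigenvalue j * b j| := fun j => by
    rw [abs_mul]
    exact le_mul_of_one_le_left (abs_nonneg _)
      ((one_le_freeEigenvalue j).trans (le_abs_self _))
  have hb' : Summable fun j => |b j| := hb.of_nonneg_of_le (fun _ => abs_nonneg _) hle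
  obtain ⟨K, hK0, hK⟩ := E.exists_bound_deriv
  have hbd : ∀ {g : ℕ → ℝ → ℝ}, (∀ j, ∀ x ∈ Icc (0 : ℝ) 1, |g j x| ≤ K * freeEigenvalue j) →
      ∀ j, ∀ x ∈ Icc (0 : ℝ) 1, |b j * g j x| ≤ |freeEigenvalue j * b j| * K := by
    intro g hg j x hx
    rw [abs_mul, abs_mul, abs_of_nonneg (by linarith [one_le_freeEigenvalue j] :
      0 ≤ freeEigenvalue j)]
    calc |b j| * |g j x| ≤ |b j| * (K * freeEigenvalue j) :=
          mul_le_mul_of_nonneg_left (hg j x hx) (abs_nonneg _)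
      _ = _ := by ring
  -- One summable majorant, K|λ_j b_j|, serves the series of functions, of first derivatives and of
  -- second derivatives, so each may be integrated termwise.
  have hs := hb.mul_right K
  have b0 := hbd fun j x hx => (hK j x hx).1.trans
    (le_mul_of_one_le_right hK0 (one_le_freeEigenvalue j))
  have b1 := hbd fun j x hx => (hK j x hx).2.1
  have b2 := hbd fun j x hx => (hK j x hx).2.2
  have sum : ∀ {g : ℕ → ℝ → ℝ}, (∀ j, ∀ x ∈ Icc (0 : ℝ) 1,
      |g j x| ≤ |freeEigenvalue j * b j| * K) → ∀ x ∈ Icc (0 : ℝ) 1, Summable fun j => g j x :=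
    fun hg x hx => Summable.of_norm_bounded hs fun j => hg j x hx
  have c1 : ∀ j, ContinuousOn (fun x => b j * f' j x) (Icc 0 1) := fun j =>
    continuousOn_const.mul (E.continuousOn_deriv j)
  have c2 : ∀ j, ContinuousOn (fun x => b j * ((q x - freeEigenvalue j) * f j x)) (Icc 0 1) :=
    fun j => continuousOn_const.mul (E.continuousOn_deriv' j)
  have h0 : (0 : ℝ) ∈ Icc (0 : ℝ) 1 := by simp
  refine ⟨fun x => ∑' j, b j * f j x, fun x => ∑' j, b j * f' j x,
    fun x => ∑' j, b j * ((q x - freeEigenvalue j) * f j x), ⟨?_, ?_, ?_, ?_, ?_⟩,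
    E.tsum_vec_ae hb', ?_⟩
  · exact ContinuousOn.memLp_unitMeasure (continuousOn_tsum c2 hs b2)
  · intro x hx
    have h := hasSum_intervalIntegral_of_bound c1 b1 hs hx
    rw [← h.tsum_eq, ← Summable.tsum_add (sum b0 0 h0) h.summable]
    congr 1; funext j
    rw [intervalIntegral.integral_const_mul, (E.isH2Dirichlet j).fst_deriv x hx]
    ring
  · intro x hx
    have h := hasSum_intervalIntegral_of_bound c2 b2 hs hx
    rw [← h.tsum_eq, ← Summable.tsum_add (sum b1 0 h0) h.summable]
    congr 1; funext j
    rw [intervalIntegral.integral_const_mul, (E.isH2Dirichlet j).snd_deriv x hx]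
    ring
  · simp [E.left]
  · simp [E.right]
  · filter_upwards [hQ, E.tsum_vec_ae hb, ae_restrict_mem measurableSet_Icc] with x hx hx' hxI
    rw [hx, hx', ← tsum_mul_left, ← tsum_neg,
      ← Summable.tsum_add (sum b2 x hxI).neg ((sum b0 x hxI).mul_left _)]
    congr 1; funext j
    ring

theorem schrodingerGraph_vec (E : IsEigenSystem q f f') {Q : L2}
    (hQ : ∀ᵐ x ∂unitMeasure, Q x = q x) (j : ℕ) :
    SchrodingerGraph Q (E.vec j) (freeEigenvalue j • E.vec j) := by
  refine ⟨f j, f' j, _, E.isH2Dirichlet j, E.vec_ae j, ?_⟩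
  filter_upwards [hQ, E.vec_ae j, Lp.coeFn_smul (freeEigenvalue j) (E.vec j)] with x h1 h2 h3
  rw [h3, Pi.smul_apply, smul_eq_mul, h1, h2]
  ring

/-- Symmetry of the operator: two integrations by parts move it onto f_j, and the boundary terms
vanish because both functions satisfy the Dirichlet conditions. -/
theorem inner_vec_of_schrodingerGraph (E : IsEigenSystem q f f') {Q : L2}
    (hQ : ∀ᵐ x ∂unitMeasure, Q x = q x) {g k : L2} (h : SchrodingerGraph Q g k) (j : ℕ) :
    inner ℝ (E.vec j) k = freeEigenvalue j * inner ℝ (E.vec j) g := by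
  obtain ⟨F, F', F'', hF, hg, hk⟩ := h
  have i2 := MemLp.intervalIntegrable_unit hF.memLp
  have c1 := continuousOn_of_primitive i2 hF.snd_deriv
  have i1 := ContinuousOn.intervalIntegrable_unit c1
  have H := E.isH2Dirichlet j
  have j2 := ContinuousOn.intervalIntegrable_unit (E.continuousOn_deriv' j)
  have j1 := ContinuousOn.intervalIntegrable_unit (E.continuousOn_deriv j)
  have e1 := integral_mul_add_mul_of_primitive i2 hF.snd_deriv j1 H.fst_deriv
  have e2 := integral_mul_add_mul_of_primitive i1 hF.fst_deriv j2 H.snd_deriv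
  have c0 := continuousOn_of_primitive i1 hF.fst_deriv
  have cf := E.continuousOn_fun j
  have cf' := E.continuousOn_deriv j
  have cf'' := E.continuousOn_deriv' j
  have hu : uIcc (0 : ℝ) 1 = Icc 0 1 := uIcc_of_le zero_le_one
  rw [hF.left, hF.right, H.left, H.right] at *
  have e3 : ∫ x in (0 : ℝ)..1, (freeEigenvalue j * (g x * f j x) - k x * f j x) = 0 := by
    have : ∫ x in (0 : ℝ)..1, ((F'' x * f j x + F' x * f' j x)
        - (F' x * f' j x + F x * ((q x - freeEigenvalue j) * f j x))) = 0 := by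
      rw [intervalIntegral.integral_sub, e1, e2]
      · simp
      · exact (i2.mul_continuousOn (hu ▸ cf)).add (i1.mul_continuousOn (hu ▸ cf'))
      · exact (i1.mul_continuousOn (hu ▸ cf')).add (j2.continuousOn_mul (hu ▸ c0))
    refine Eq.trans ?_ this
    apply integral_congr_unitMeasure
    filter_upwards [hQ, hg, hk] with x h1 h2 h3
    rw [h3, h2, h1]
    ring
  rw [intervalIntegral.integral_sub, intervalIntegral.integral_const_mul, sub_eq_zero] at e3
  · rw [E.inner_vec, E.inner_vec, e3]
  · exact ((L2.intervalIntegrable g).mul_continuousOn (hu ▸ cf)).const_mul _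
  · exact (L2.intervalIntegrable k).mul_continuousOn (hu ▸ cf)

/-- By symmetry an eigenvector for any other value would be orthogonal to every f_j, hence zero by
completeness. -/
theorem isEigenvalue_iff (E : IsEigenSystem q f f') {Q : L2}
    (hQ : ∀ᵐ x ∂unitMeasure, Q x = q x) (l : ℝ) :
    IsEigenvalue Q l ↔ ∃ j, l = freeEigenvalue j := by
  constructor
  · rintro ⟨g, hg0, hg⟩
    by_contra! hl
    refine hg0 (E.ext_inner fun j => ?_)
    have := E.inner_vec_of_schrodingerGraph hQ hg j
    rw [inner_smul_right] at this
    rw [inner_zero_right]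
    exact (mul_eq_mul_right_iff.1 this).resolve_left (hl j)
  · rintro ⟨j, rfl⟩
    exact ⟨E.vec j, E.orthonormal_vec.ne_zero j, E.schrodingerGraph_vec hQ j⟩

/-- Eigenvalues are indexed from 0 here and from 1 in `IsNthEigenvalue`; strict monotonicity leaves
exactly j of them below the given one. -/
theorem isNthEigenvalue (E : IsEigenSystem q f f') {Q : L2}
    (hQ : ∀ᵐ x ∂unitMeasure, Q x = q x) (j : ℕ) :
    IsNthEigenvalue Q (j + 1) (freeEigenvalue j) := by
  refine ⟨(E.isEigenvalue_iff hQ _).2 ⟨j, rfl⟩, ?_⟩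
  have : {m : ℝ | IsEigenvalue Q m ∧ m < freeEigenvalue j}
      = freeEigenvalue '' (Finset.range j : Set ℕ) := by
    ext m
    simp only [mem_ofPred_eq, E.isEigenvalue_iff hQ, mem_image, Finset.mem_coe, Finset.mem_range]
    constructor
    · rintro ⟨⟨i, rfl⟩, h⟩
      exact ⟨i, freeEigenvalue_strictMono.lt_iff_lt.1 h, rfl⟩
    · rintro ⟨i, h, rfl⟩
      exact ⟨⟨i, rfl⟩, freeEigenvalue_strictMono h⟩
  rw [this, freeEigenvalue_strictMono.injective.encard_image, encard_coe_eq_coe_finsetCard,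
    Finset.card_range]
  norm_cast

/-! ### Heat flow and heat content -/

/-- The constant function `1` in `L²[0,1]`. -/
abbrev one : L2 := Lp.const 2 unitMeasure (1 : ℝ)

theorem abs_inner_vec_le (E : IsEigenSystem q f f') (j : ℕ) (h : L2) :
    |inner ℝ (E.vec j) h| ≤ ‖h‖ := by
  have := abs_real_inner_le_norm (E.vec j) h
  rwa [E.norm_vec, one_mul] at this

theorem summable_heat (E : IsEigenSystem q f f') (h : L2) {t : ℝ} (ht : 0 < t) :
    Summable fun j => |freeEigenvalue j *
      (Real.exp (-freeEigenvalue j * t) * inner ℝ (E.vec j) h)| := by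
  refine ((summable_freeEigenvalue_mul_exp ht).mul_right ‖h‖).of_nonneg_of_le
    (fun _ => abs_nonneg _) fun j => ?_
  have := one_le_freeEigenvalue j
  rw [← mul_assoc, abs_mul, abs_of_nonneg (by positivity)]
  exact mul_le_mul_of_nonneg_left (E.abs_inner_vec_le j h) (by positivity)

theorem summable_heat' (E : IsEigenSystem q f f') (h : L2) {t : ℝ} (ht : 0 < t) :
    Summable fun j => |Real.exp (-freeEigenvalue j * t) * inner ℝ (E.vec j) h| :=
  (E.summable_heat h ht).of_nonneg_of_le (fun _ => abs_nonneg _) fun j => by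
    rw [abs_mul (freeEigenvalue j)]
    exact le_mul_of_one_le_left (abs_nonneg _) ((one_le_freeEigenvalue j).trans (le_abs_self _))

/-- The heat flow `exp(-tL) h` as an eigenfunction expansion. -/
def heat (E : IsEigenSystem q f f') (h : L2) (t : ℝ) : L2 :=
  ∑' j, (Real.exp (-freeEigenvalue j * t) * inner ℝ (E.vec j) h) • E.vec j

/-- Termwise differentiation is justified on (t/2, ∞), where the derivatives are dominated by the
summable λ_j e^{-λ_j t/2} ‖h‖. -/
theorem hasDerivAt_heat (E : IsEigenSystem q f f') (h : L2) {t : ℝ} (ht : 0 < t) :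
    HasDerivAt (E.heat h) (-∑' j, (freeEigenvalue j *
      (Real.exp (-freeEigenvalue j * t) * inner ℝ (E.vec j) h)) • E.vec j) t := by
  rw [← tsum_neg]
  have ht2 : 0 < t / 2 := by linarith
  have hd : ∀ j, ∀ y ∈ Ioi (t / 2), HasDerivAt
      (fun y => (Real.exp (-freeEigenvalue j * y) * inner ℝ (E.vec j) h) • E.vec j)
      (-((freeEigenvalue j * (Real.exp (-freeEigenvalue j * y) * inner ℝ (E.vec j) h))
        • E.vec j)) y := by
    intro j y _
    have h1 : HasDerivAt (fun y => Real.exp (-freeEigenvalue j * y) * inner ℝ (E.vec j) h)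
        (Real.exp (-freeEigenvalue j * y) * (-freeEigenvalue j * 1) * inner ℝ (E.vec j) h) y :=
      (((hasDerivAt_id y).const_mul _).exp).mul_const _
    convert! h1.smul_const (E.vec j) using 1
    rw [← neg_smul]
    congr 1
    ring
  refine hasDerivAt_tsum_of_isPreconnected
    ((summable_freeEigenvalue_mul_exp ht2).mul_right ‖h‖) isOpen_Ioi isPreconnected_Ioi hd ?_
    (y₀ := t) (by simp [ht]) (E.summable_smul_vec (E.summable_heat' h ht)) (by simp [ht])
  intro j y hy
  have h1 := one_le_freeEigenvalue j
  rw [norm_neg, norm_smul, E.norm_vec, mul_one, Real.norm_eq_abs, ← mul_assoc, abs_mul,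
    abs_of_nonneg (by positivity)]
  refine mul_le_mul (mul_le_mul_of_nonneg_left (Real.exp_le_exp.2 ?_) (by positivity))
    (E.abs_inner_vec_le j h) (abs_nonneg _) (by positivity)
  have : t / 2 < y := hy
  nlinarith

/-- Parseval turns ‖heat(t) - h‖² into Σ (e^{-λ_j t} - 1)² ⟨f_j, h⟩², and dominated convergence
applies with majorant ⟨f_j, h⟩². -/
theorem tendsto_heat (E : IsEigenSystem q f f') (h : L2) :
    Tendsto (E.heat h) (𝓝[>] 0) (𝓝 h) := by
  have hsq : Summable fun j => inner ℝ (E.vec j) h ^ 2 := by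
    have := E.basis.summable_inner_mul_inner h h
    simp only [E.basis_apply] at this
    refine this.congr fun j => ?_
    rw [real_inner_comm, sq]
  have hnorm : ∀ g : L2, ‖g‖ ^ 2 = ∑' j, inner ℝ (E.vec j) g ^ 2 := by
    intro g
    rw [← real_inner_self_eq_norm_sq, ← E.basis.tsum_inner_mul_inner g g]
    congr 1; funext j
    rw [E.basis_apply, real_inner_comm, sq]
  have hlim : Tendsto (fun t => ∑' j, ((Real.exp (-freeEigenvalue j * t) - 1)
      * inner ℝ (E.vec j) h) ^ 2) (𝓝[>] 0) (𝓝 (∑' j : ℕ, (0 : ℝ))) := by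
    refine tendsto_tsum_of_dominated_convergence hsq ?_ ?_
    · intro j
      have : Continuous fun t => ((Real.exp (-freeEigenvalue j * t) - 1)
        * inner ℝ (E.vec j) h) ^ 2 := by fun_prop
      have h2 := this.tendsto 0
      simp only [mul_zero, Real.exp_zero, sub_self, zero_mul] at h2
      simpa using h2.mono_left nhdsWithin_le_nhds
    · filter_upwards [self_mem_nhdsWithin] with t ht j
      have ht' : 0 < t := ht
      have h1 := one_le_freeEigenvalue j
      have he : Real.exp (-freeEigenvalue j * t) ≤ 1 := by
        rw [Real.exp_le_one_iff]
        nlinarith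
      have he' := Real.exp_pos (-freeEigenvalue j * t)
      rw [Real.norm_eq_abs, abs_of_nonneg (sq_nonneg _), mul_pow]
      refine mul_le_of_le_one_left (sq_nonneg _) ?_
      nlinarith
  rw [tendsto_iff_norm_sub_tendsto_zero]
  have h3 : Tendsto (fun t => ‖E.heat h t - h‖ ^ 2) (𝓝[>] 0) (𝓝 0) := by
    rw [tsum_zero] at hlim
    refine hlim.congr' ?_
    filter_upwards [self_mem_nhdsWithin] with t ht
    rw [hnorm]
    congr 1; funext j
    rw [inner_sub_right, heat, E.inner_vec_tsum (E.summable_heat' h ht), sub_mul, one_mul]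
  have := h3.sqrt
  simpa [Real.sqrt_sq (norm_nonneg _)] using this

theorem isHeatSolution_heat (E : IsEigenSystem q f f') {Q : L2}
    (hQ : ∀ᵐ x ∂unitMeasure, Q x = q x) : IsHeatSolution Q (E.heat one) :=
  ⟨fun _ ht => ⟨_, E.schrodingerGraph_tsum hQ (E.summable_heat one ht), E.hasDerivAt_heat one ht⟩,
    E.tendsto_heat one⟩

/-- The function e^{λ_j t} ⟨f_j, u(t)⟩ has zero derivative for t > 0, and the initial condition
fixes its value. This uniqueness is needed because `heatContent` is defined through an arbitrary
choice of solution. -/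
theorem inner_vec_of_isHeatSolution (E : IsEigenSystem q f f') {Q : L2}
    (hQ : ∀ᵐ x ∂unitMeasure, Q x = q x) {u : ℝ → L2} (hu : IsHeatSolution Q u) (j : ℕ)
    {t : ℝ} (ht : 0 < t) :
    inner ℝ (E.vec j) (u t) = Real.exp (-freeEigenvalue j * t) * inner ℝ (E.vec j) one := by
  set l := freeEigenvalue j
  have hd : ∀ y ∈ Ioi (0 : ℝ), HasDerivAt
      (fun y => Real.exp (l * y) * inner ℝ (E.vec j) (u y)) 0 y := by
    intro y hy
    obtain ⟨v, hv, hd⟩ := hu.1 y hy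
    have h1 : HasDerivAt (fun y => Real.exp (l * y)) (Real.exp (l * y) * (l * 1)) y :=
      ((hasDerivAt_id y).const_mul l).exp
    have h2 := (innerSL ℝ (E.vec j)).hasFDerivAt.comp_hasDerivAt y hd
    have h3 : HasDerivAt (fun y => inner ℝ (E.vec j) (u y)) (inner ℝ (E.vec j) (-v)) y := h2
    convert! h1.mul h3 using 1
    rw [inner_neg_right, E.inner_vec_of_schrodingerGraph hQ hv]
    ring
  obtain ⟨c, hc⟩ := isOpen_Ioi.exists_is_const_of_deriv_eq_zero isPreconnected_Ioi
    (fun y hy => (hd y hy).differentiableAt.differentiableWithinAt) (fun y hy => (hd y hy).deriv)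
  have l1 : Tendsto (fun y => Real.exp (l * y) * inner ℝ (E.vec j) (u y)) (𝓝[>] 0)
      (𝓝 (Real.exp (l * 0) * inner ℝ (E.vec j) one)) := by
    refine Tendsto.mul ?_ ?_
    · exact (Continuous.tendsto (by fun_prop) 0).mono_left nhdsWithin_le_nhds
    · exact ((innerSL ℝ (E.vec j)).continuous.tendsto _).comp hu.2
  have l2 : Tendsto (fun y => Real.exp (l * y) * inner ℝ (E.vec j) (u y)) (𝓝[>] 0) (𝓝 c) :=
    tendsto_const_nhds.congr' (by
      filter_upwards [self_mem_nhdsWithin] with y hy using (hc y hy).symm)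
  have hc' := tendsto_nhds_unique l1 l2
  have h4 : Real.exp (l * t) * inner ℝ (E.vec j) (u t) = c := hc t ht
  rw [← hc', mul_zero, Real.exp_zero, one_mul] at h4
  rw [← h4, ← mul_assoc, ← Real.exp_add]
  simp

theorem inner_vec_one (E : IsEigenSystem q f f') (j : ℕ) :
    inner ℝ (E.vec j) one = ∫ x in (0 : ℝ)..1, f j x := by
  rw [E.inner_vec]
  apply integral_congr_unitMeasure
  filter_upwards [Lp.coeFn_const 2 unitMeasure (1 : ℝ)] with x hx
  rw [hx, Function.const_apply, one_mul]

theorem summable_integral_sq (E : IsEigenSystem q f f') :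
    Summable fun j => (∫ x in (0 : ℝ)..1, f j x) ^ 2 := by
  refine (E.basis.summable_inner_mul_inner one one).congr fun j => ?_
  rw [E.basis_apply, real_inner_comm, E.inner_vec_one, sq]

theorem heatContent_eq (E : IsEigenSystem q f f') {Q : L2}
    (hQ : ∀ᵐ x ∂unitMeasure, Q x = q x) {t : ℝ} (ht : 0 < t) :
    heatContent Q t
      = ∑' j, Real.exp (-freeEigenvalue j * t) * (∫ x in (0 : ℝ)..1, f j x) ^ 2 := by
  have hex : ∃ u : ℝ → L2, IsHeatSolution Q u := ⟨_, E.isHeatSolution_heat hQ⟩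
  rw [heatContent, dif_pos hex]
  have hu := hex.choose_spec
  set u := hex.choose
  have e : ∫ x, u t x ∂unitMeasure = inner ℝ one (u t) := by
    rw [inner_eq_integral, integral_unitMeasure]
    apply integral_congr_unitMeasure
    filter_upwards [Lp.coeFn_const 2 unitMeasure (1 : ℝ)] with x hx
    rw [hx, Function.const_apply, mul_one]
  rw [e, ← E.basis.tsum_inner_mul_inner]
  congr 1; funext j
  rw [E.basis_apply, E.inner_vec_of_isHeatSolution hQ hu j ht, real_inner_comm, E.inner_vec_one]
  ring

end IsEigenSystem

/-! ### Heat content determines the squared means -/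

/-- A Dirichlet series with exponents `freeEigenvalue j` that vanishes identically on `t > 0` has
vanishing coefficients. -/
theorem eq_zero_of_tsum_exp_eq_zero {d : ℕ → ℝ} (hd : Summable fun j => |d j|)
    (h : ∀ t : ℝ, 0 < t → ∑' j, Real.exp (-freeEigenvalue j * t) * d j = 0) (j : ℕ) : d j = 0 := by
  induction j using Nat.strong_induction_on with
  | _ m ih =>
    -- After multiplication by e^{λ_m t} the terms below m vanish by induction and those above decay
    -- as t → ∞, so the limit isolates d_m; the series itself is identically zero.
    have hlim : Tendsto (fun t => ∑' j, Real.exp (-(freeEigenvalue j - freeEigenvalue m) * t) * d j)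
        atTop (𝓝 (∑' j, if j = m then d m else 0)) := by
      refine tendsto_tsum_of_dominated_convergence hd ?_ ?_
      · intro j
        rcases lt_trichotomy j m with hj | rfl | hj
        · simp [ih j hj, hj.ne]
        · simp
        · rw [if_neg hj.ne', ← zero_mul (d j)]
          refine Tendsto.mul_const _ (Real.tendsto_exp_atBot.comp ?_)
          exact tendsto_id.const_mul_atTop_of_neg
            (by linarith [freeEigenvalue_strictMono hj])
      · filter_upwards [eventually_gt_atTop 0] with t ht j
        rcases lt_or_ge j m with hj | hj
        · simp [ih j hj]
        · rw [norm_mul, Real.norm_eq_abs, Real.norm_eq_abs, abs_of_pos (Real.exp_pos _)]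
          refine mul_le_of_le_one_left (abs_nonneg _) ?_
          rw [Real.exp_le_one_iff]
          have := freeEigenvalue_strictMono.monotone hj
          nlinarith
    rw [tsum_ite_eq] at hlim
    refine tendsto_nhds_unique hlim (tendsto_const_nhds.congr' ?_)
    filter_upwards [eventually_gt_atTop 0] with t ht
    have := congrArg (fun z => Real.exp (freeEigenvalue m * t) * z) (h t ht)
    simp only [mul_zero, ← tsum_mul_left] at this
    rw [← this]
    congr 1; funext j
    rw [← mul_assoc, ← Real.exp_add]
    ring_nf

/-- Potentials with eigenvalues `freeEigenvalue j` are isoheat only if all their eigenfunctions have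
the same mean values up to sign. -/
theorem IsEigenSystem.integral_sq_eq_of_isIsoheat {q₁ q₂ : ℝ → ℝ} {f f' g g' : ℕ → ℝ → ℝ}
    (E₁ : IsEigenSystem q₁ f f') (E₂ : IsEigenSystem q₂ g g') {Q₁ Q₂ : L2}
    (h₁ : ∀ᵐ x ∂unitMeasure, Q₁ x = q₁ x) (h₂ : ∀ᵐ x ∂unitMeasure, Q₂ x = q₂ x)
    (H : IsIsoheat Q₁ Q₂) (j : ℕ) :
    (∫ x in (0 : ℝ)..1, f j x) ^ 2 = (∫ x in (0 : ℝ)..1, g j x) ^ 2 := by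
  rw [← sub_eq_zero]
  have s1 := E₁.summable_integral_sq
  have s2 := E₂.summable_integral_sq
  refine eq_zero_of_tsum_exp_eq_zero (d := fun j => (∫ x in (0 : ℝ)..1, f j x) ^ 2
    - (∫ x in (0 : ℝ)..1, g j x) ^ 2) (s1.sub s2).abs (fun t ht => ?_) j
  have hs : ∀ {d : ℕ → ℝ}, Summable d → (∀ j, 0 ≤ d j) →
      Summable fun j => Real.exp (-freeEigenvalue j * t) * d j := fun hd h0 =>
    hd.of_nonneg_of_le (fun j => mul_nonneg (Real.exp_pos _).le (h0 j)) fun j =>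
      mul_le_of_le_one_left (h0 j) (Real.exp_le_one_iff.2 (by
        have := one_le_freeEigenvalue j
        nlinarith))
  have := H t ht
  rw [E₁.heatContent_eq h₁ ht, E₂.heatContent_eq h₂ ht] at this
  simp only [mul_sub]
  rw [Summable.tsum_sub (hs s1 fun j => sq_nonneg _) (hs s2 fun j => sq_nonneg _), this, sub_self]

/-! ### Free eigenfunctions and their partial pairings -/

/-- The normalized Dirichlet eigenfunctions `√2 sin(kπx)` of the zero potential. -/
def sine (k : ℕ) (x : ℝ) : ℝ := √2 * Real.sin (k * Real.pi * x)

/-- The derivative of `sine k`. -/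
def sineDeriv (k : ℕ) (x : ℝ) : ℝ := √2 * (k * Real.pi) * Real.cos (k * Real.pi * x)

theorem hasDerivAt_sine (k : ℕ) (x : ℝ) : HasDerivAt (sine k) (sineDeriv k x) x := by
  have h := (((hasDerivAt_id x).const_mul (k * Real.pi)).sin).const_mul (√2)
  convert! h using 1
  simp only [sineDeriv, id]
  ring

theorem hasDerivAt_sineDeriv (k : ℕ) (x : ℝ) :
    HasDerivAt (sineDeriv k) (-(k * Real.pi) ^ 2 * sine k x) x := by
  have h := (((hasDerivAt_id x).const_mul (k * Real.pi)).cos).const_mul (√2 * (k * Real.pi))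
  convert! h using 1
  simp only [sine, id]
  ring

theorem continuous_sine (k : ℕ) : Continuous (sine k) := by unfold sine; fun_prop

theorem sine_zero (k : ℕ) : sine k 0 = 0 := by simp [sine]

theorem sine_one (k : ℕ) : sine k 1 = 0 := by simp [sine, Real.sin_nat_mul_pi]

theorem abs_sine_le (k : ℕ) (x : ℝ) : |sine k x| ≤ √2 := by
  rw [sine, abs_mul, abs_of_nonneg (Real.sqrt_nonneg 2)]
  exact mul_le_of_le_one_right (Real.sqrt_nonneg 2) (Real.abs_sin_le_one _)

theorem sqrt_two_sq : √2 ^ 2 = (2 : ℝ) := Real.sq_sqrt (by norm_num)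

/-- `∫_x^1 sine n · sine k`. -/
def sinePairing (n k : ℕ) (x : ℝ) : ℝ := ∫ r in x..(1 : ℝ), sine n r * sine k r

theorem hasDerivAt_sinePairing (n k : ℕ) (x : ℝ) :
    HasDerivAt (sinePairing n k) (-(sine n x * sine k x)) x := by
  have hc : Continuous fun r => sine n r * sine k r := (continuous_sine n).mul (continuous_sine k)
  exact intervalIntegral.integral_hasDerivAt_left (hc.intervalIntegrable _ _)
    (hc.stronglyMeasurableAtFilter _ _) hc.continuousAt

theorem sinePairing_one (n k : ℕ) : sinePairing n k 1 = 0 := by simp [sinePairing]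

theorem sinePairing_zero_self {n : ℕ} (hn : 1 ≤ n) : sinePairing n n 0 = 1 := by
  have hc : (n * Real.pi : ℝ) ≠ 0 := by positivity
  have : ∀ r, sine n r * sine n r = 2 * Real.sin (n * Real.pi * r) ^ 2 := fun r => by
    rw [← sqrt_two_sq, sine]; ring
  simp only [sinePairing, this]
  rw [intervalIntegral.integral_const_mul,
    intervalIntegral.integral_comp_mul_left (fun y => Real.sin y ^ 2) hc, integral_sin_sq]
  simp [Real.sin_nat_mul_pi]
  field_simp

/-- The Wronskian identity for two free eigenfunctions. -/
theorem mul_sinePairing (n k : ℕ) (x : ℝ) :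
    ((k * Real.pi) ^ 2 - (n * Real.pi) ^ 2) * sinePairing n k x
      = sine n x * sineDeriv k x - sineDeriv n x * sine k x := by
  -- The two sides have equal derivatives and both vanish at 1.
  have hd : ∀ y, HasDerivAt (fun y => ((k * Real.pi) ^ 2 - (n * Real.pi) ^ 2) * sinePairing n k y
      - (sine n y * sineDeriv k y - sineDeriv n y * sine k y)) 0 y := by
    intro y
    have := ((hasDerivAt_sinePairing n k y).const_mul ((k * Real.pi) ^ 2 - (n * Real.pi) ^ 2)).sub
      (((hasDerivAt_sine n y).mul (hasDerivAt_sineDeriv k y)).sub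
        ((hasDerivAt_sineDeriv n y).mul (hasDerivAt_sine k y)))
    convert! this using 1
    ring
  have := is_const_of_deriv_eq_zero (fun y => (hd y).differentiableAt) (fun y => (hd y).deriv) x 1
  simp only [sinePairing_one, sine_one] at this
  linarith

theorem sinePairing_zero_of_ne {n k : ℕ} (h : n ≠ k) : sinePairing n k 0 = 0 := by
  have := mul_sinePairing n k 0
  rw [sine_zero, sine_zero, zero_mul, mul_zero, sub_zero, mul_eq_zero] at this
  refine this.resolve_left fun h0 => h ?_
  rw [sub_eq_zero, sq_eq_sq₀ (by positivity) (by positivity)] at h0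
  exact_mod_cast (mul_right_cancel₀ Real.pi_ne_zero h0).symm

theorem abs_sinePairing_le (n k : ℕ) {x : ℝ} (hx : x ∈ Icc (0 : ℝ) 1) :
    |sinePairing n k x| ≤ 2 := by
  have h := intervalIntegral.norm_integral_le_of_norm_le_const (a := x) (b := 1) (C := 2)
    (f := fun r => sine n r * sine k r) fun r _ => by
      rw [Real.norm_eq_abs, abs_mul, ← sqrt_two_sq, sq]
      exact mul_le_mul (abs_sine_le n r) (abs_sine_le k r) (abs_nonneg _) (Real.sqrt_nonneg 2)
  rw [Real.norm_eq_abs, abs_of_nonneg (by linarith [hx.2] : 0 ≤ 1 - x)] at h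
  refine h.trans ?_
  linarith [hx.1]

theorem theta_eq (n : ℕ) (s x : ℝ) :
    theta n s x = 1 + (Real.exp s - 1) * sinePairing n n x := by
  have : ∀ r, sine n r * sine n r = 2 * Real.sin (n * Real.pi * r) ^ 2 := fun r => by
    rw [← sqrt_two_sq, sine]; ring
  simp only [theta, sinePairing, this]

theorem hasDerivAt_theta (n : ℕ) (s x : ℝ) :
    HasDerivAt (theta n s) (-((Real.exp s - 1) * sine n x ^ 2)) x := by
  have h := ((hasDerivAt_sinePairing n n x).const_mul (Real.exp s - 1)).const_add 1
  rw [← funext (theta_eq n s)] at h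
  convert! h using 1
  ring

theorem theta_zero {n : ℕ} (hn : 1 ≤ n) (s : ℝ) : theta n s 0 = Real.exp s := by
  rw [theta_eq, sinePairing_zero_self hn]
  ring

/-! ### The double commutation transform -/

/-- `sine n / θ_n`, the `n`-th eigenfunction of `γ_n(s)` up to normalization. -/
def ratio (n : ℕ) (s x : ℝ) : ℝ := sine n x / theta n s x

/-- The derivative of `ratio n s`. -/
def ratioDeriv (n : ℕ) (s x : ℝ) : ℝ :=
  sineDeriv n x / theta n s x + (Real.exp s - 1) * sine n x ^ 3 / theta n s x ^ 2

theorem hasDerivAt_ratio (n : ℕ) (s : ℝ) {x : ℝ} (hx : theta n s x ≠ 0) :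
    HasDerivAt (ratio n s) (ratioDeriv n s x) x := by
  have h := (hasDerivAt_sine n x).div (hasDerivAt_theta n s x) hx
  convert! h using 1
  rw [ratioDeriv]
  field_simp
  ring

/-- The closed form of `γ_n(s)`. -/
def potential (n : ℕ) (s x : ℝ) : ℝ :=
  2 * (Real.exp s - 1) * (2 * sine n x * sineDeriv n x / theta n s x
    + (Real.exp s - 1) * sine n x ^ 4 / theta n s x ^ 2)

theorem hasDerivAt_ratioDeriv (n : ℕ) (s : ℝ) {x : ℝ} (hx : theta n s x ≠ 0) :
    HasDerivAt (ratioDeriv n s) ((potential n s x - (n * Real.pi) ^ 2) * ratio n s x) x := by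
  have h := ((hasDerivAt_sineDeriv n x).div (hasDerivAt_theta n s x) hx).add
    ((((hasDerivAt_sine n x).pow 3).const_mul (Real.exp s - 1)).div
      ((hasDerivAt_theta n s x).pow 2) (pow_ne_zero 2 hx))
  convert! h using 1
  rw [potential, ratio]
  simp only [Pi.pow_apply]
  field_simp
  ring

theorem gammaFun_eq (n : ℕ) (s : ℝ) {x : ℝ} (hx : x ∈ Icc (0 : ℝ) 1) :
    gammaFun n s x = potential n s x := by
  have hpos := theta_pos n s hx
  have hev : ∀ᶠ y in 𝓝 x, theta n s y ≠ 0 :=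
    (contDiff_theta n s).continuous.continuousAt.eventually_ne hpos.ne'
  have h1 : deriv (fun y => Real.log (theta n s y))
      =ᶠ[𝓝 x] fun y => -((Real.exp s - 1) * sine n y ^ 2) / theta n s y := by
    filter_upwards [hev] with y hy
    exact ((hasDerivAt_theta n s y).log hy).deriv
  have h2 := ((((hasDerivAt_sine n x).pow 2).const_mul (Real.exp s - 1)).neg).div
    (hasDerivAt_theta n s x) hpos.ne'
  rw [gammaFun, iteratedDeriv_succ, iteratedDeriv_one, h1.deriv_eq]
  refine (congrArg (fun z => -2 * z) h2.deriv).trans ?_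
  rw [potential]
  simp only [Pi.pow_apply, Pi.neg_apply]
  have := hpos.ne'
  field_simp
  ring

theorem gammaFlow_ae (n : ℕ) (s : ℝ) : ∀ᵐ x ∂unitMeasure, gammaFlow n s x = potential n s x := by
  filter_upwards [MemLp.coeFn_toLp (memLp_gammaFun n s),
    ae_unitMeasure_of_forall fun x hx => gammaFun_eq n s hx] with x h1 h2
  rw [gammaFlow, h1, h2]

/-- The double commutation transform of `sine k`. -/
def transform (n : ℕ) (s : ℝ) (k : ℕ) (x : ℝ) : ℝ :=
  sine k x - (Real.exp s - 1) * (ratio n s x * sinePairing n k x)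

/-- The derivative of `transform n s k`. -/
def transformDeriv (n : ℕ) (s : ℝ) (k : ℕ) (x : ℝ) : ℝ :=
  sineDeriv k x - (Real.exp s - 1) *
    (ratioDeriv n s x * sinePairing n k x - ratio n s x * (sine n x * sine k x))

theorem hasDerivAt_transform (n : ℕ) (s : ℝ) (k : ℕ) {x : ℝ} (hx : theta n s x ≠ 0) :
    HasDerivAt (transform n s k) (transformDeriv n s k x) x := by
  have h := (hasDerivAt_sine k x).sub
    (((hasDerivAt_ratio n s hx).mul (hasDerivAt_sinePairing n k x)).const_mul (Real.exp s - 1))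
  convert! h using 1
  rw [transformDeriv]
  ring

/-- Two facts close the computation: the potential is 2c (`ratio` · `sine n`)' with c = e^s - 1, and
the Wronskian identity trades the energy (nπ)² of `ratio` for (kπ)². -/
theorem hasDerivAt_transformDeriv (n : ℕ) (s : ℝ) (k : ℕ) {x : ℝ} (hx : theta n s x ≠ 0) :
    HasDerivAt (transformDeriv n s k)
      ((potential n s x - (k * Real.pi) ^ 2) * transform n s k x) x := by
  have h := (hasDerivAt_sineDeriv k x).sub
    ((((hasDerivAt_ratioDeriv n s hx).mul (hasDerivAt_sinePairing n k x)).sub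
      ((hasDerivAt_ratio n s hx).mul
        ((hasDerivAt_sine n x).mul (hasDerivAt_sine k x)))).const_mul (Real.exp s - 1))
  convert! h using 1
  have hW := mul_sinePairing n k x
  have hp : potential n s x
      = 2 * (Real.exp s - 1) * (ratioDeriv n s x * sine n x + ratio n s x * sineDeriv n x) := by
    rw [potential, ratio, ratioDeriv]
    field_simp
    ring
  rw [transform]
  simp only [Pi.mul_apply]
  linear_combination (sine k x) * hp + (Real.exp s - 1) * ratio n s x * hW

theorem transform_zero (n : ℕ) (s : ℝ) (k : ℕ) : transform n s k 0 = 0 := by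
  simp [transform, ratio, sine_zero]

theorem transform_one (n : ℕ) (s : ℝ) (k : ℕ) : transform n s k 1 = 0 := by
  simp [transform, ratio, sine_one]

/-- This is 1 - c P/θ = 1/θ, where θ = 1 + cP. -/
theorem transform_self (n : ℕ) (s : ℝ) {x : ℝ} (hx : theta n s x ≠ 0) :
    transform n s n x = ratio n s x := by
  have h := theta_eq n s x
  rw [transform, ratio]
  field_simp
  rw [h]
  ring

theorem continuousOn_theta (n : ℕ) (s : ℝ) (S : Set ℝ) : ContinuousOn (theta n s) S :=
  (contDiff_theta n s).continuous.continuousOn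

theorem continuousOn_ratio (n : ℕ) (s : ℝ) : ContinuousOn (ratio n s) (Icc 0 1) :=
  (continuous_sine n).continuousOn.div (continuousOn_theta n s _) fun _ hx => (theta_pos n s hx).ne'

theorem continuousOn_transform (n : ℕ) (s : ℝ) (k : ℕ) :
    ContinuousOn (transform n s k) (Icc 0 1) := fun _ hx =>
  (hasDerivAt_transform n s k (theta_pos n s hx).ne').continuousAt.continuousWithinAt

theorem continuous_sinePairing (n k : ℕ) : Continuous (sinePairing n k) :=
  continuous_iff_continuousAt.2 fun x => (hasDerivAt_sinePairing n k x).continuousAt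

theorem continuousOn_potential (n : ℕ) (s : ℝ) : ContinuousOn (potential n s) (Icc 0 1) := by
  have h1 := continuousOn_theta n s (Icc 0 1)
  have h2 : ContinuousOn (sine n) (Icc 0 1) := (continuous_sine n).continuousOn
  have h3 : ContinuousOn (sineDeriv n) (Icc 0 1) := by unfold sineDeriv; fun_prop
  have h4 : ∀ x ∈ Icc (0 : ℝ) 1, theta n s x ≠ 0 := fun x hx => (theta_pos n s hx).ne'
  have h5 : ∀ x ∈ Icc (0 : ℝ) 1, theta n s x ^ 2 ≠ 0 := fun x hx => pow_ne_zero 2 (h4 x hx)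
  unfold potential
  exact continuousOn_const.mul (((((continuousOn_const.mul h2).mul h3).div h1 h4)).add
    ((continuousOn_const.mul (h2.pow 4)).div (h1.pow 2) h5))

/-- The product has the explicit antiderivative -P_{ij} + c P_{ni} P_{nj}/θ. All pairings vanish at
1, so only the values at 0 survive. -/
theorem integral_transform_mul_transform (n : ℕ) (s : ℝ) (i j : ℕ) :
    ∫ x in (0 : ℝ)..1, transform n s i x * transform n s j x
      = sinePairing i j 0
        - (Real.exp s - 1) * (sinePairing n i 0 * sinePairing n j 0 / theta n s 0) := by
  have hd : ∀ x ∈ uIcc (0 : ℝ) 1, HasDerivAt (fun x => -sinePairing i j x + (Real.exp s - 1) *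
      (sinePairing n i x * sinePairing n j x / theta n s x))
      (transform n s i x * transform n s j x) x := by
    intro x hx
    rw [uIcc_of_le zero_le_one] at hx
    have hne := (theta_pos n s hx).ne'
    have h := (hasDerivAt_sinePairing i j x).neg.add
      ((((hasDerivAt_sinePairing n i x).mul (hasDerivAt_sinePairing n j x)).div
        (hasDerivAt_theta n s x) hne).const_mul (Real.exp s - 1))
    convert! h using 1
    simp only [transform, ratio, Pi.mul_apply]
    field_simp
    ring
  rw [intervalIntegral.integral_eq_sub_of_hasDerivAt hd]
  · simp [sinePairing_one]
    ring
  · refine ContinuousOn.intervalIntegrable ?_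
    rw [uIcc_of_le zero_le_one]
    exact (continuousOn_transform n s i).mul (continuousOn_transform n s j)

/-- The transforms of the free eigenfunctions are complete. -/
theorem eq_zero_of_integral_mul_transform (n : ℕ) (s : ℝ) (h : L2)
    (hh : ∀ j : ℕ, ∫ x in (0 : ℝ)..1, h x * transform n s (j + 1) x = 0) : h = 0 := by
  set c := Real.exp s - 1 with hc
  have hu : uIcc (0 : ℝ) 1 = Icc 0 1 := uIcc_of_le zero_le_one
  have hi := L2.intervalIntegrable h
  have hp : IntervalIntegrable (fun x => ratio n s x * h x) volume 0 1 :=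
    hi.continuousOn_mul (hu ▸ continuousOn_ratio n s)
  set A : ℝ → ℝ := fun x => ∫ r in (0 : ℝ)..x, ratio n s r * h r with hA
  have hA0 : A 0 = 0 := by simp [hA]
  have hAp : ∀ x ∈ Icc (0 : ℝ) 1, A x = A 0 + ∫ r in (0 : ℝ)..x, ratio n s r * h r := by
    intro x _
    rw [hA0, zero_add]
  have hAc : ContinuousOn A (Icc 0 1) := continuousOn_of_primitive hp hAp
  have hsA : ContinuousOn (fun x => c * sine n x * A x) (Icc 0 1) :=
    (continuousOn_const.mul (continuous_sine n).continuousOn).mul hAc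
  have hsAL := ContinuousOn.memLp_unitMeasure hsA
  -- Integrating by parts against A rewrites the hypothesis as orthogonality of h - c s_n A to every
  -- sine, so h = c s_n A.
  have key : h - hsAL.toLp _ = 0 := by
    refine L2.eq_zero_of_integral_mul_sin _ fun j => ?_
    have hg : Continuous fun r => -(sine n r * sine (j + 1) r) :=
      ((continuous_sine n).mul (continuous_sine _)).neg
    have ibp := integral_mul_add_mul_of_primitive hp hAp (hg.intervalIntegrable 0 1)
      (eq_add_integral_of_hasDerivAt (fun x _ => hasDerivAt_sinePairing n (j + 1) x)
        hg.continuousOn)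
    rw [sinePairing_one, hA0, mul_zero, zero_mul, sub_zero] at ibp
    have e : ∫ x in (0 : ℝ)..1, (h x * transform n s (j + 1) x
        + c * (ratio n s x * h x * sinePairing n (j + 1) x
          + A x * -(sine n x * sine (j + 1) x))) = 0 := by
      rw [intervalIntegral.integral_add, hh j, intervalIntegral.integral_const_mul, ibp]
      · simp
      · exact hi.mul_continuousOn (hu ▸ continuousOn_transform n s _)
      · refine IntervalIntegrable.const_mul (IntervalIntegrable.add ?_ ?_) c
        · exact hp.mul_continuousOn (continuous_sinePairing n (j + 1)).continuousOn
        · exact ContinuousOn.intervalIntegrable (hu ▸ hAc.mul hg.continuousOn)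
    have e2 := congrArg (fun z => (√2)⁻¹ * z) e
    simp only [mul_zero, ← intervalIntegral.integral_const_mul] at e2
    refine Eq.trans ?_ e2
    apply integral_congr_unitMeasure
    filter_upwards [hsAL.coeFn_toLp, Lp.coeFn_sub h (hsAL.toLp _)] with x h1 h2
    rw [h2, Pi.sub_apply, h1, transform]
    have h2' : (√2 : ℝ) ≠ 0 := by positivity
    have h3 : Real.sin ((j + 1 : ℝ) * Real.pi * x) = (√2)⁻¹ * sine (j + 1) x := by
      rw [sine, inv_mul_cancel_left₀ h2']
      push_cast
      rfl
    rw [h3]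
    ring
  have hae : ∀ᵐ x ∂unitMeasure, h x = c * sine n x * A x := by
    filter_upwards [hsAL.coeFn_toLp] with x h1
    rw [sub_eq_zero.1 key, h1]
  -- Now h agrees almost everywhere with a continuous function, so A is differentiable at every
  -- point and satisfies a linear first-order equation.
  have hAd : ∀ x ∈ Icc (0 : ℝ) 1,
      HasDerivWithinAt A (ratio n s x * (c * sine n x * A x)) (Icc 0 1) x := by
    intro x hx
    refine (hasDerivWithinAt_integral_of_continuousOn ((continuousOn_ratio n s).mul hsA)
      hx).congr_of_mem (fun y hy => ?_) hx
    refine integral_congr_unitMeasure_of_mem ?_ hy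
    filter_upwards [hae] with r hr
    rw [hr, Pi.mul_apply]
  -- The equation reads A' = c (s_n²/θ) A = -(θ'/θ) A, so Aθ is constant; it vanishes at 0.
  have hAt : ∀ x ∈ Icc (0 : ℝ) 1,
      HasDerivWithinAt (fun x => A x * theta n s x) 0 (Icc 0 1) x := by
    intro x hx
    have hne := (theta_pos n s hx).ne'
    convert! (hAd x hx).mul (hasDerivAt_theta n s x).hasDerivWithinAt using 1
    rw [ratio]
    field_simp
    ring
  have hA' : ∀ x ∈ Icc (0 : ℝ) 1, A x = 0 := by
    intro x hx
    have := constant_of_derivWithin_zero (fun y hy => (hAt y hy).differentiableWithinAt)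
      (fun y hy => (hAt y (Ico_subset_Icc_self hy)).derivWithin
        (uniqueDiffOn_Icc zero_lt_one y (Ico_subset_Icc_self hy))) x hx
    simp only [hA0, zero_mul] at this
    exact (mul_eq_zero.1 this).resolve_right (theta_pos n s hx).ne'
  rw [Lp.eq_zero_iff_ae_eq_zero]
  filter_upwards [hae, ae_unitMeasure_of_forall hA'] with x h1 h2
  simp [h1, h2]

/-- The normalization constant of the `j`-th eigenfunction of `γ_n(s)`. -/
def normalization (n : ℕ) (s : ℝ) (j : ℕ) : ℝ := if j + 1 = n then Real.exp (s / 2) else 1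

theorem normalization_pos (n : ℕ) (s : ℝ) (j : ℕ) : 0 < normalization n s j := by
  unfold normalization
  split_ifs <;> positivity

theorem isEigenSystem_potential {n : ℕ} (hn : 1 ≤ n) (s : ℝ) :
    IsEigenSystem (potential n s) (fun j x => normalization n s j * transform n s (j + 1) x)
      (fun j x => normalization n s j * transformDeriv n s (j + 1) x) where
  continuousOn := continuousOn_potential n s
  hasDerivAt j x hx := (hasDerivAt_transform n s (j + 1) (theta_pos n s hx).ne').const_mul _
  hasDerivAt' j x hx := by
    convert! (hasDerivAt_transformDeriv n s (j + 1) (theta_pos n s hx).ne').const_mul _ using 1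
    rw [freeEigenvalue]
    push_cast
    ring
  left j := by simp [transform_zero]
  right j := by simp [transform_one]
  bounded := by
    obtain ⟨C, hC⟩ := isCompact_Icc.exists_bound_of_continuousOn (continuousOn_ratio n s)
    refine ⟨(1 + Real.exp (s / 2)) * (√2 + |Real.exp s - 1| * (C * 2)), fun j x hx => ?_⟩
    have h1 : |normalization n s j| ≤ 1 + Real.exp (s / 2) := by
      rw [abs_of_pos (normalization_pos n s j), normalization]
      have := Real.exp_pos (s / 2)
      split_ifs <;> linarith
    have hC0 : 0 ≤ C := (norm_nonneg _).trans (hC x hx)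
    rw [abs_mul]
    refine mul_le_mul h1 ?_ (abs_nonneg _) (by positivity)
    refine (abs_sub _ _).trans (add_le_add (abs_sine_le _ _) ?_)
    rw [abs_mul, abs_mul]
    exact mul_le_mul_of_nonneg_left (mul_le_mul (hC x hx) (abs_sinePairing_le n _ hx)
      (abs_nonneg _) hC0) (abs_nonneg _)
  orthonormal i j := by
    have e : ∀ x, normalization n s i * transform n s (i + 1) x
        * (normalization n s j * transform n s (j + 1) x)
        = normalization n s i * normalization n s j
          * (transform n s (i + 1) x * transform n s (j + 1) x) := fun x => by ring
    simp only [e]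
    rw [intervalIntegral.integral_const_mul, integral_transform_mul_transform, theta_zero hn]
    rcases eq_or_ne i j with rfl | hij
    · rw [if_pos rfl, sinePairing_zero_self (by omega), normalization]
      split_ifs with h
      -- Before normalization the squared norm is 1 - (e^s - 1)e^{-s} = e^{-s}, whence the factor
      -- e^{s/2}.
      · rw [h, sinePairing_zero_self hn, ← Real.exp_add, add_halves]
        have := Real.exp_ne_zero s
        field_simp
        ring
      · rw [sinePairing_zero_of_ne (Ne.symm h)]
        ring
    · rw [if_neg hij, sinePairing_zero_of_ne (by omega)]
      rcases eq_or_ne n (i + 1) with h | h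
      · rw [sinePairing_zero_of_ne (k := j + 1) (by omega)]
        ring
      · rw [sinePairing_zero_of_ne h]
        ring
  complete h hh := by
    refine eq_zero_of_integral_mul_transform n s h fun j => ?_
    have := hh j
    simp only [mul_left_comm _ (normalization n s j)] at this
    rw [intervalIntegral.integral_const_mul] at this
    exact (mul_eq_zero.1 this).resolve_left (normalization_pos n s j).ne'

/-! ### The flow equation and isospectrality -/

/-- A family of functions on `[0,1]` whose derivative in the parameter is jointly continuous is
differentiable as a curve in `L²[0,1]`. -/
theorem hasDerivAt_L2_of_continuous {Γ Γ' : ℝ → ℝ → ℝ} {γ : ℝ → L2}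
    (hγ : ∀ s, ∀ᵐ x ∂unitMeasure, γ s x = Γ s x)
    (hd : ∀ s, ∀ x ∈ Icc (0 : ℝ) 1, HasDerivAt (fun s => Γ s x) (Γ' s x) s)
    (hc : Continuous fun p : ℝ × Icc (0 : ℝ) 1 => Γ' p.1 p.2) {s : ℝ} {v : L2}
    (hv : ∀ᵐ x ∂unitMeasure, v x = Γ' s x) : HasDerivAt γ v s := by
  rw [hasDerivAt_iff_isLittleO, Asymptotics.isLittleO_iff]
  intro ε hε
  -- Currying over the compact interval makes y ↦ Γ' y continuous in the sup norm. The mean value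
  -- inequality for Γ y x - y Γ' s x is then uniform in x.
  let F : C(ℝ, C(Icc (0 : ℝ) 1, ℝ)) := ContinuousMap.curry ⟨_, hc⟩
  obtain ⟨δ, hδ, hF⟩ := Metric.continuousAt_iff.1 (F.continuous.continuousAt (x := s)) ε hε
  filter_upwards [Metric.ball_mem_nhds s hδ] with s' hs'
  have hbd : ∀ x ∈ Icc (0 : ℝ) 1, |Γ s' x - Γ s x - (s' - s) * Γ' s x| ≤ ε * |s' - s| := by
    intro x hx
    have h := (convex_ball s δ).norm_image_sub_le_of_norm_hasDerivWithin_le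
      (f := fun y => Γ y x - y * Γ' s x) (f' := fun y => Γ' y x - 1 * Γ' s x) (C := ε)
      (fun y _ => ((hd y x hx).sub ((hasDerivAt_id y).mul_const _)).hasDerivWithinAt)
      (fun y hy => by
        rw [one_mul]
        exact (ContinuousMap.dist_apply_le_dist (f := F y) (g := F s) ⟨x, hx⟩).trans (hF hy).le)
      (Metric.mem_ball_self hδ) hs'
    rw [Real.norm_eq_abs, Real.norm_eq_abs] at h
    convert! h using 2
    ring
  have hae : ∀ᵐ x ∂unitMeasure, ‖(γ s' - γ s - (s' - s) • v : L2) x‖ ≤ ε * |s' - s| := by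
    filter_upwards [Lp.coeFn_sub (γ s' - γ s) ((s' - s) • v), Lp.coeFn_sub (γ s') (γ s),
      Lp.coeFn_smul (s' - s) v, hγ s', hγ s, hv, ae_unitMeasure_of_forall hbd]
      with x h1 h2 h3 h4 h5 h6 h7
    rwa [h1, Pi.sub_apply, h2, Pi.sub_apply, h3, Pi.smul_apply, smul_eq_mul, h4, h5, h6]
  have := Lp.norm_le_of_ae_bound (by positivity) hae
  simpa [measureUnivNNReal] using this

/-- The closed form of the derivative of `s ↦ γ_n(s)`. -/
def velocity (n : ℕ) (s x : ℝ) : ℝ := 4 * Real.exp s * (ratio n s x * ratioDeriv n s x)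

/-- Since θ - cP = 1, one has ∂_x(e^s P/θ) = -e^s `ratio`², and -2∂_x of this is the velocity. Here
the identity is checked on the closed form of the potential. -/
theorem hasDerivAt_potential (n : ℕ) (s : ℝ) {x : ℝ} (hx : x ∈ Icc (0 : ℝ) 1) :
    HasDerivAt (fun s => potential n s x) (velocity n s x) s := by
  have hne := (theta_pos n s hx).ne'
  have hθ : HasDerivAt (fun s => theta n s x) (Real.exp s * sinePairing n n x) s := by
    have := (((Real.hasDerivAt_exp s).sub_const 1).mul_const (sinePairing n n x)).const_add 1
    rwa [← funext fun s => theta_eq n s x] at this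
  have hc := (Real.hasDerivAt_exp s).sub_const 1
  have h := (hc.const_mul 2).mul
    (((hasDerivAt_const s (2 * sine n x * sineDeriv n x)).div hθ hne).add
      ((hc.mul_const (sine n x ^ 4)).div (hθ.pow 2) (pow_ne_zero 2 hne)))
  convert! h using 1
  have hB := theta_eq n s x
  rw [velocity, ratio, ratioDeriv]
  simp only [Pi.pow_apply, Pi.add_apply, Pi.div_apply]
  generalize Real.exp s = e at *
  generalize theta n s x = θ at *
  generalize sinePairing n n x = B at *
  field_simp
  rw [hB]
  ring

theorem continuous_velocity (n : ℕ) :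
    Continuous fun p : ℝ × Icc (0 : ℝ) 1 => velocity n p.1 p.2 := by
  have h1 : Continuous fun p : ℝ × Icc (0 : ℝ) 1 => theta n p.1 p.2 := by
    simp only [theta_eq]
    have := continuous_sinePairing n n
    fun_prop
  have h2 : ∀ p : ℝ × Icc (0 : ℝ) 1, theta n p.1 p.2 ≠ 0 := fun p => (theta_pos n p.1 p.2.2).ne'
  have h3 : ∀ p : ℝ × Icc (0 : ℝ) 1, theta n p.1 p.2 ^ 2 ≠ 0 := fun p => pow_ne_zero 2 (h2 p)
  have h4 : Continuous fun p : ℝ × Icc (0 : ℝ) 1 => sine n p.2 :=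
    (continuous_sine n).comp (by fun_prop)
  have h5 : Continuous fun p : ℝ × Icc (0 : ℝ) 1 => sineDeriv n p.2 := by
    unfold sineDeriv
    fun_prop
  have h6 : Continuous fun p : ℝ × Icc (0 : ℝ) 1 => Real.exp p.1 := by fun_prop
  unfold velocity ratio ratioDeriv
  exact (continuous_const.mul h6).mul ((h4.div h1 h2).mul ((h5.div h1 h2).add
    (((h6.sub continuous_const).mul (h4.pow 3)).div (h1.pow 2) h3)))

theorem transformDeriv_self (n : ℕ) (s : ℝ) {x : ℝ} (hx : theta n s x ≠ 0) :
    transformDeriv n s n x = ratioDeriv n s x := by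
  have h := theta_eq n s x
  rw [transformDeriv, ratio, ratioDeriv]
  generalize theta n s x = θ at *
  generalize sinePairing n n x = B at *
  field_simp
  rw [h]
  ring

theorem gammaFlow_zero (n : ℕ) : gammaFlow n 0 = 0 := by
  rw [Lp.eq_zero_iff_ae_eq_zero]
  filter_upwards [gammaFlow_ae n 0] with x hx
  simp [hx, potential]

/-- The normalized n-th eigenfunction is e^{s/2} `ratio`, so twice the derivative of its square is
exactly `velocity`. -/
theorem isFlowLine_gammaFlow {n : ℕ} (hn : 1 ≤ n) : IsFlowLine n 0 (gammaFlow n) := by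
  refine ⟨gammaFlow_zero n, fun s => ?_⟩
  have hcont : ContinuousOn (velocity n s) (Icc 0 1) := by
    rw [continuousOn_iff_continuous_domRestrict]
    exact (continuous_velocity n).comp (by fun_prop : Continuous fun x : Icc (0 : ℝ) 1 => (s, x))
  have hL := ContinuousOn.memLp_unitMeasure hcont
  refine ⟨hL.toLp _, ?_, hasDerivAt_L2_of_continuous (gammaFlow_ae n)
    (fun s x hx => hasDerivAt_potential n s hx) (continuous_velocity n) hL.coeFn_toLp⟩
  obtain ⟨m, rfl⟩ : ∃ m, n = m + 1 := ⟨n - 1, by omega⟩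
  have E := isEigenSystem_potential hn s
  have hnorm : normalization (m + 1) s m = Real.exp (s / 2) := if_pos rfl
  have h0 : (0 : ℝ) ∈ Icc (0 : ℝ) 1 := by simp
  refine ⟨_, _, ⟨freeEigenvalue m, _, E.isNthEigenvalue (gammaFlow_ae _ s) m, E.isH2Dirichlet m,
    ?_, ?_, ?_⟩, ?_⟩
  · filter_upwards [gammaFlow_ae (m + 1) s] with x hx
    rw [hx]
    ring
  · simpa [sq] using E.orthonormal m m
  · have hpos := theta_pos (m + 1) s h0
    rw [hnorm, transformDeriv_self _ _ hpos.ne', ratioDeriv, sine_zero, sineDeriv]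
    simp only [mul_zero, Real.cos_zero, mul_one, zero_pow three_ne_zero, zero_div, add_zero]
    positivity
  · filter_upwards [hL.coeFn_toLp, ae_restrict_mem measurableSet_Icc] with x h1 hx
    have hne := (theta_pos (m + 1) s hx).ne'
    have hd := (E.hasDerivAt m x hx).pow 2
    rw [h1]
    refine Eq.trans ?_ (congrArg (fun z => 2 * z) hd.deriv.symm)
    rw [hnorm, transform_self _ _ hne, transformDeriv_self _ _ hne, velocity]
    have : Real.exp s = Real.exp (s / 2) ^ 2 := by
      rw [sq, ← Real.exp_add, add_halves]
    rw [this]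
    push_cast
    ring

/-- The zero potential is the member s = 0 of the family, and every member has the eigenvalue set
`freeEigenvalue`. -/
theorem isospectral_gammaFlow {n : ℕ} (hn : 1 ≤ n) (s : ℝ) : Isospectral (gammaFlow n s) 0 := by
  intro j _ l
  have h : ∀ m, IsEigenvalue (gammaFlow n s) m ↔ IsEigenvalue 0 m := fun m => by
    rw [← gammaFlow_zero n, (isEigenSystem_potential hn s).isEigenvalue_iff (gammaFlow_ae n s),
      (isEigenSystem_potential hn 0).isEigenvalue_iff (gammaFlow_ae n 0)]
  simp only [IsNthEigenvalue, h]

/-! ### The mean of the 2n-th eigenfunction -/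

/-- By the double angle formula the integrand is 4 sin²(nπr) cos(nπr), the exact derivative of a
multiple of sin³(nπr). -/
theorem sinePairing_two_mul {n : ℕ} (hn : 1 ≤ n) (x : ℝ) :
    sinePairing n (2 * n) x = -(4 / (3 * (n * Real.pi)) * Real.sin (n * Real.pi * x) ^ 3) := by
  have hne : (n * Real.pi : ℝ) ≠ 0 := by positivity
  have hd : ∀ y, HasDerivAt (fun y => sinePairing n (2 * n) y
      - -(4 / (3 * (n * Real.pi)) * Real.sin (n * Real.pi * y) ^ 3)) 0 y := by
    intro y
    have := (hasDerivAt_sinePairing n (2 * n) y).sub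
      ((((((hasDerivAt_id y).const_mul (n * Real.pi)).sin).pow 3).const_mul
        (4 / (3 * (n * Real.pi)))).neg)
    convert! this using 1
    have e : sine (2 * n) y = √2 * (2 * Real.sin (n * Real.pi * y) * Real.cos (n * Real.pi * y)) := by
      rw [sine, ← Real.sin_two_mul]
      push_cast
      ring_nf
    rw [e, sine]
    simp only [id]
    field_simp
    rw [sqrt_two_sq]
    push_cast
    ring
  have := is_const_of_deriv_eq_zero (fun y => (hd y).differentiableAt) (fun y => (hd y).deriv) x 1
  simp only [sinePairing_one, mul_one, Real.sin_nat_mul_pi] at this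
  linarith

theorem integral_sine_two_mul {n : ℕ} (hn : 1 ≤ n) : ∫ x in (0 : ℝ)..1, sine (2 * n) x = 0 := by
  have h := intervalIntegral.integral_eq_sub_of_hasDerivAt (a := 0) (b := 1)
    (fun x _ => hasDerivAt_sineDeriv (2 * n) x)
    ((continuous_const.mul (continuous_sine (2 * n))).intervalIntegrable _ _)
  have e : Real.cos ((2 * n : ℕ) * Real.pi * 1) = 1 := by
    rw [show ((2 * n : ℕ) * Real.pi * 1 : ℝ) = n * (2 * Real.pi) by push_cast; ring,
      Real.cos_nat_mul_two_pi]
  rw [intervalIntegral.integral_const_mul, sineDeriv, sineDeriv, e, mul_zero, Real.cos_zero,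
    sub_self, mul_eq_zero] at h
  refine h.resolve_left ?_
  have : (0 : ℝ) < (2 * n : ℕ) := by exact_mod_cast (by omega : 0 < 2 * n)
  have := mul_pos this Real.pi_pos
  exact neg_ne_zero.2 (by positivity)

/-- The free part has mean zero, and the cube in the pairing meets the remaining sine in `ratio`,
giving a fourth power of definite sign. -/
theorem integral_transform_two_mul {n : ℕ} (hn : 1 ≤ n) (s : ℝ) :
    ∫ x in (0 : ℝ)..1, transform n s (2 * n) x = (Real.exp s - 1) * (4 * √2 / (3 * (n * Real.pi)) *
      ∫ x in (0 : ℝ)..1, Real.sin (n * Real.pi * x) ^ 4 / theta n s x) := by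
  have hu : uIcc (0 : ℝ) 1 = Icc 0 1 := uIcc_of_le zero_le_one
  simp only [transform]
  rw [intervalIntegral.integral_sub, integral_sine_two_mul hn, zero_sub,
    ← intervalIntegral.integral_neg, ← intervalIntegral.integral_const_mul,
    ← intervalIntegral.integral_const_mul]
  · congr 1
    funext x
    rw [sinePairing_two_mul hn, ratio, sine]
    ring
  · exact (continuous_sine _).intervalIntegrable _ _
  · refine ContinuousOn.intervalIntegrable ?_
    rw [hu]
    exact continuousOn_const.mul ((continuousOn_ratio n s).mul
      (continuous_sinePairing n _).continuousOn)

theorem integral_transform_two_mul_ne_zero {n : ℕ} (hn : 1 ≤ n) {s : ℝ} (hs : s ≠ 0) :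
    ∫ x in (0 : ℝ)..1, transform n s (2 * n) x ≠ 0 := by
  rw [integral_transform_two_mul hn]
  refine mul_ne_zero (sub_ne_zero.2 ((Real.exp_eq_one_iff s).not.2 hs)) (ne_of_gt (mul_pos ?_ ?_))
  · positivity
  · refine intervalIntegral.integral_pos zero_lt_one ?_ ?_ ?_
    · exact ContinuousOn.div (by fun_prop) (continuousOn_theta n s _)
        fun x hx => (theta_pos n s hx).ne'
    · intro x hx
      have := theta_pos n s (Ioc_subset_Icc_self hx)
      positivity
    · have h1 : (1 : ℝ) ≤ n := by exact_mod_cast hn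
      -- At x = 1/(2n) the sine equals 1, so the nonnegative integrand is not identically zero.
      have hx : (1 / (2 * n) : ℝ) ∈ Icc (0 : ℝ) 1 := by
        refine ⟨by positivity, ?_⟩
        rw [div_le_one (by positivity)]
        linarith
      refine ⟨_, hx, div_pos ?_ (theta_pos n s hx)⟩
      rw [show n * Real.pi * (1 / (2 * n)) = Real.pi / 2 by field_simp, Real.sin_pi_div_two]
      norm_num

/-- No potential `γ_n(s)` with `s ≠ 0` is isoheat to the zero potential. -/
theorem not_isIsoheat_gammaFlow {n : ℕ} (hn : 1 ≤ n) {s : ℝ} (hs : s ≠ 0) :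
    ¬ IsIsoheat (gammaFlow n s) 0 := by
  intro H
  rw [← gammaFlow_zero n] at H
  have h := (isEigenSystem_potential hn s).integral_sq_eq_of_isIsoheat
    -- The zero-based index 2n - 1 selects the frequency 2n; at s = 0 the corresponding mean
    -- vanishes.
    (isEigenSystem_potential hn 0) (gammaFlow_ae n s) (gammaFlow_ae n 0) H (2 * n - 1)
  have e : 2 * n - 1 + 1 = 2 * n := by omega
  simp only [intervalIntegral.integral_const_mul, e] at h
  rw [integral_transform_two_mul hn 0, Real.exp_zero, sub_self, zero_mul, mul_zero,
    zero_pow two_ne_zero, sq_eq_zero_iff, mul_eq_zero] at h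
  exact h.elim (normalization_pos n s _).ne' (integral_transform_two_mul_ne_zero hn hs)

end Isoheat

end

theorem theorem2 (n : ℕ) (hn : 1 ≤ n) :
    Isoheat.IsFlowLine n 0 (Isoheat.gammaFlow n) ∧
    (∀ s : ℝ, Isoheat.Isospectral (Isoheat.gammaFlow n s) 0) ∧
    ¬ Isoheat.IsIsoheatDeformation (Isoheat.gammaFlow n) ∧
    ∃ ε : ℝ, 0 < ε ∧ ∀ s : ℝ, s ≠ 0 → |s| < ε →
      ¬ Isoheat.IsIsoheat (Isoheat.gammaFlow n s) 0 := by
  -- The choice ε = 1 is arbitrary, since every s ≠ 0 works.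
  refine ⟨Isoheat.isFlowLine_gammaFlow hn, Isoheat.isospectral_gammaFlow hn, fun h => ?_,
    1, one_pos, fun s hs _ => Isoheat.not_isIsoheat_gammaFlow hn hs⟩
  have h1 := h 1 0
  rw [Isoheat.gammaFlow_zero] at h1
  exact Isoheat.not_isIsoheat_gammaFlow hn one_ne_zero h1
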